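/- Let $n\ge 2$. The contracted zigzag graph $\widehat{\mathrm{Zig}}_n$ has vertices $1,\dots,n$, slack edges $x_i:i\to i+1$ ($1\le i\le n-1$) and nonslack edges $y_0:1\to 2$, $y_i:i\to i+2$ ($1\le i\le n-2$), $y_{n-1}:n-1\to n$. The length-reverse-length framing orders, at every inner vertex $i\in\{2,\dots,n-1\}$, the incoming edges by $y_{i-2}\prec x_{i-1}$ and the outgoing edges by $x_i\prec y_i$. For an inner vertex $i$, two different paths from $1$ to $i$ (prefixes at $i$) are compared by the two edges along which they come together for the last time, and two different paths from $i$ to $n$ (suffixes at $i$) by the two edges along which they first diverge. A route is a path from $1$ to $n$. Two routes are coherent if there is no common inner vertex $i$ at which, writing them as $PiQ$ and $P'iQ'$, one has $P\prec P'$ and $Q'\prec Q$, or $P'\prec P$ and $Q\prec Q'$. A maximal clique is an inclusion-maximal set $C$ of pairwise coherent routes. Its simplex $\Delta_C$ is the convex hull of the indicator vectors (in $\mathbb R^{E}$) of the routes in $C$; these simplices are the maximal cells of the DKK triangulation $\mathcal T_n^{LRL}$ of the flow polytope $\mathcal F_{\widehat{\mathrm{Zig}}_n}(1,0,\dots,0,-1)$.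 Two different simplices are adjacent if they share a codimension 1 face. The grove of $C$ is $\Gamma=(\gamma_2,\dots,\gamma_{n-1})$, where $\gamma_i$ is the bipartite graph whose left vertices $l_1,\dots,l_{p_i}$ are the prefixes at $i$ that occur in routes of $C$, numbered in increasing order (from bottom to top), whose right vertices $r_1,r_2$ are the outgoing edges $x_i,y_i$, and in which a prefix $P$ and an edge $e$ are joined if some route of $C$ begins with $Pe$. The integer flow of $C$ is the function $\phi$ on the edges with $\phi(e)=0$ if $e$ leaves vertex $1$, and $\phi(e)=\deg_{\gamma_i}(e)-1$ if $e$ leaves the inner vertex $i$. In general, a grove is a sequence $(\gamma_2,\dots,\gamma_{n-1})$ of noncrossing bipartite trees, $\gamma_i$ having $p_i$ left and two right vertices, such that $p_i$ is the sum over the incoming edges $e$ of $i$ of the degree of the right vertex corresponding to $e$ in the tree of the source of $e$ (replaced by $1$ if the source is vertex $1$). Let $\mathcal F_n^{\mathbb Z}$ be the set of nonnegative integer flows on $\widehat{\mathrm{Zig}}_n$ whose net flow vector $\mathbf d$ is the shifted in-degree vector: $d_1=0$, $d_i=\mathrm{indeg}(i)-1$ for inner $i$, and $d_n=-\sum_{i=2}^{n-1}d_i$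 (that is, $\mathbf d=(0,1,\dots,1,-(n-2))$ for $n\ge 3$, and $\mathbf d=(0,0)$ for $n=2$). For $2\le i\le n-1$, the elementary move $m_i^+$ on flows applies to $\phi$ if $\phi(x_i)>0$ and $\phi(y_{i+1})>0$; it subtracts $1$ from $\phi(x_i)$ and $\phi(y_{i+1})$ and adds $1$ to $\phi(x_{i+2})$ and $\phi(y_i)$. The move $m_i^-$ applies to $\phi$ if $\phi(x_{i+2})>0$ and $\phi(y_i)>0$; it subtracts $1$ from $\phi(x_{i+2})$ and $\phi(y_i)$ and adds $1$ to $\phi(x_i)$ and $\phi(y_{i+1})$. (Conditions and operations on edges that do not exist are ignored.) For $2\le i\le n-1$, the elementary move $m_i^+$ on groves replaces, in $\gamma_i$, the edge $l_jr_1$ by $l_{j-1}r_2$, where $l_j$ is the left vertex adjacent to both $r_1$ and $r_2$ (if $j=1$, the move does not apply); if $i<n-1$, it deletes the top left vertex of $\gamma_{i+1}$ with its incident edge (if this vertex is adjacent to both right vertices, the move does not apply); if $i<n-2$, it adds to $\gamma_{i+2}$ a new left vertex $l_0$ at the bottom (after which the left vertices are renumbered) and the edge $l_0r_1$; all other trees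 stay unchanged. The move $m_i^-$ on groves is the inverse operation. Theorem. Let $C$ and $C'$ be maximal cliques such that $\Delta_C$ and $\Delta_{C'}$ are adjacent, and let $\phi,\phi'$ and $\Gamma,\Gamma'$ be their integer flows and groves. Then: (a) $\phi,\phi'\in\mathcal F_n^{\mathbb Z}$, and for some $2\le i\le n-1$ the move $m_i^+$ or $m_i^-$ applies to $\phi$ and takes it to $\phi'$; (b) $\Gamma$ and $\Gamma'$ are groves, and for some $2\le i\le n-1$ the move $m_i^+$ or $m_i^-$ on groves applies to $\Gamma$ and takes it to $\Gamma'$. -/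

import Mathlib

namespace CZig

/-! ### The contracted zigzag graph with the length-reverse-length framing

The vertices are the natural numbers `1, …, n` (with `2 ≤ n`). -/

/-- The edges: `Sum.inl k` is the slack edge `x_{k+1}` (so the slack edges are `x_1, …, x_{n-1}`),
and `Sum.inr k` is the nonslack edge `y_k` (so the nonslack edges are `y_0, …, y_{n-1}`). -/
abbrev Edge (n : ℕ) : Type := Fin (n - 1) ⊕ Fin n

/-- `e` is the slack edge `x_m`; there is no such edge unless `1 ≤ m ≤ n - 1`. -/
def IsX {n : ℕ} (m : ℕ) : Edge n → Prop
  | Sum.inl k => k.val + 1 = m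
  | Sum.inr _ => False

/-- `e` is the nonslack edge `y_m`; there is no such edge unless `0 ≤ m ≤ n - 1`. -/
def IsY {n : ℕ} (m : ℕ) : Edge n → Prop
  | Sum.inl _ => False
  | Sum.inr k => k.val = m

instance {n : ℕ} (m : ℕ) : DecidablePred (IsX (n := n) m)
  | Sum.inl k => inferInstanceAs (Decidable (k.val + 1 = m))
  | Sum.inr _ => inferInstanceAs (Decidable False)

instance {n : ℕ} (m : ℕ) : DecidablePred (IsY (n := n) m)
  | Sum.inl _ => inferInstanceAs (Decidable False)
  | Sum.inr k => inferInstanceAs (Decidable (k.val = m))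

/-- The source of an edge: `x_i` and `y_i` start at `i`, except that `y_0` starts at `1`. -/
def src {n : ℕ} : Edge n → ℕ
  | Sum.inl k => k.val + 1
  | Sum.inr k => if k.val = 0 then 1 else k.val

/-- The target of an edge: `x_i` ends at `i + 1`, `y_0` ends at `2`, `y_{n-1}` ends at `n`, and
any other `y_i` ends at `i + 2`. -/
def tgt {n : ℕ} : Edge n → ℕ
  | Sum.inl k => k.val + 2
  | Sum.inr k => if k.val = n - 1 then n else k.val + 2

/-- The inner vertices `2, …, n - 1`. -/
def inner (n : ℕ) : Finset ℕ := Finset.Icc 2 (n - 1)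

/-- The framing on incoming edges: at an inner vertex, nonslack edges precede slack edges. -/
def InLt {n : ℕ} (e e' : Edge n) : Prop :=
  tgt e = tgt e' ∧ tgt e ∈ inner n ∧ e.isRight ∧ e'.isLeft

/-- The framing on outgoing edges: at an inner vertex, slack edges precede nonslack edges. -/
def OutLt {n : ℕ} (e e' : Edge n) : Prop :=
  src e = src e' ∧ src e ∈ inner n ∧ e.isLeft ∧ e'.isRight

/-- The position (`1` or `2`) of an edge among the outgoing edges of its (inner) source. -/
def outPos {n : ℕ} : Edge n → ℕ
  | Sum.inl _ => 1
  | Sum.inr _ => 2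

/-! ### Routes, coherence, maximal cliques -/

/-- `IsPath a P b`: the list of edges `P` is a directed path from `a` to `b`. -/
def IsPath {n : ℕ} : ℕ → List (Edge n) → ℕ → Prop
  | a, [], b => a = b
  | a, e :: P, b => src e = a ∧ IsPath (tgt e) P b

/-- A route is a path from `1` to `n`. -/
def IsRoute {n : ℕ} (R : List (Edge n)) : Prop := IsPath 1 R n

/-- The order on prefixes: `S` is the longest common tail of `P` and `P'`, and `e`, `e'` are the
edges along which they come together. -/
def PrefixLt {n : ℕ} (P P' : List (Edge n)) : Prop :=
  ∃ (A A' S : List (Edge n)) (e e' : Edge n),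
    P = A ++ e :: S ∧ P' = A' ++ e' :: S ∧ InLt e e'

/-- The order on suffixes: `S` is the longest common initial segment of `Q` and `Q'`, and `e`, `e'`
are the edges along which they diverge. -/
def SuffixLt {n : ℕ} (Q Q' : List (Edge n)) : Prop :=
  ∃ (S A A' : List (Edge n)) (e e' : Edge n),
    Q = S ++ e :: A ∧ Q' = S ++ e' :: A' ∧ OutLt e e'

/-- The routes `R = PiQ` and `R' = P'iQ'` are in conflict at the inner vertex `i` if the prefixes
and the suffixes are ordered in opposite ways. -/
def ConflictAt {n : ℕ} (i : ℕ) (R R' : List (Edge n)) : Prop :=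
  ∃ P Q P' Q' : List (Edge n),
    R = P ++ Q ∧ R' = P' ++ Q' ∧ IsPath 1 P i ∧ IsPath i Q n ∧ IsPath 1 P' i ∧ IsPath i Q' n ∧
    ((PrefixLt P P' ∧ SuffixLt Q' Q) ∨ (PrefixLt P' P ∧ SuffixLt Q Q'))

/-- Two routes are coherent if they are in conflict at no common inner vertex. -/
def Coherent {n : ℕ} (R R' : List (Edge n)) : Prop := ∀ i ∈ inner n, ¬ ConflictAt i R R'

/-- A clique is a set of pairwise coherent routes. -/
def IsClique {n : ℕ} (C : Set (List (Edge n))) : Prop :=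
  (∀ R ∈ C, IsRoute R) ∧ ∀ R ∈ C, ∀ R' ∈ C, Coherent R R'

/-- A maximal clique is a clique that is maximal under inclusion. -/
def IsMaximalClique {n : ℕ} (C : Set (List (Edge n))) : Prop := Maximal IsClique C

/-! ### Simplices of the triangulation and their adjacency -/

/-- The unit flow along a route (`1` on its edges and `0` elsewhere), a vertex of the flow polytope. -/
noncomputable def routeVec {n : ℕ} (R : List (Edge n)) : Edge n → ℝ := Set.indicator {e | e ∈ R} 1

/-- The simplex `Δ_C` of a set `C` of routes: the convex hull of their unit flows. The simplices of
the DKK triangulation are the `simplex C` for the maximal cliques `C`. -/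
def simplex {n : ℕ} (C : Set (List (Edge n))) : Set (Edge n → ℝ) :=
  convexHull ℝ (routeVec '' C)

/-- A codimension 1 face of a simplex: the convex hull of all its vertices but one. -/
def IsFacet {n : ℕ} (F Δ : Set (Edge n → ℝ)) : Prop :=
  ∃ v ∈ Δ.extremePoints ℝ, F = convexHull ℝ (Δ.extremePoints ℝ \ {v})

/-- Two different simplices are adjacent if they share a codimension 1 face. -/
def Adjacent {n : ℕ} (Δ Δ' : Set (Edge n → ℝ)) : Prop :=
  Δ ≠ Δ' ∧ ∃ F, IsFacet F Δ ∧ IsFacet F Δ'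

/-! ### Groves -/

/-- A bipartite graph with left vertices `l_1, …, l_p` and right vertices `r_1, r_2`, numbered from
bottom to top; the pair `(j, k)` stands for the edge `l_j r_k`. -/
@[ext]
structure BipGraph where
  /-- the number of left vertices -/
  p : ℕ
  /-- the edges -/
  edges : Set (ℕ × ℕ)

/-- The degree of the right vertex `r_k`. -/
noncomputable def BipGraph.deg (γ : BipGraph) (k : ℕ) : ℕ := {j | (j, k) ∈ γ.edges}.ncard

/-- The underlying simple graph; `Fin` is numbered from `0`. -/
def BipGraph.toSimpleGraph (γ : BipGraph) : SimpleGraph (Fin γ.p ⊕ Fin 2) :=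
  SimpleGraph.fromRel fun a b => ∃ (j : Fin γ.p) (k : Fin 2),
    a = Sum.inl j ∧ b = Sum.inr k ∧ (j.val + 1, k.val + 1) ∈ γ.edges

/-- A noncrossing bipartite tree. -/
def BipGraph.IsNoncrossingTree (γ : BipGraph) : Prop :=
  (∀ t ∈ γ.edges, (1 ≤ t.1 ∧ t.1 ≤ γ.p) ∧ (1 ≤ t.2 ∧ t.2 ≤ 2)) ∧
  γ.toSimpleGraph.IsTree ∧
  ∀ t ∈ γ.edges, ∀ t' ∈ γ.edges, t.1 < t'.1 → t.2 ≤ t'.2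

/-- The number of left vertices that the edge `e : h → i` contributes to the `i`-th tree. -/
noncomputable def edgeDeg {n : ℕ} (Γ : ℕ → BipGraph) (e : Edge n) : ℕ :=
  if src e = 1 then 1 else (Γ (src e)).deg (outPos e)

/-- `Γ = (γ_2, …, γ_{n-1})` is a grove; the values of `Γ` at other indices are irrelevant. -/
def IsGrove (n : ℕ) (Γ : ℕ → BipGraph) : Prop :=
  ∀ i ∈ inner n, (Γ i).IsNoncrossingTree ∧
    (Γ i).p = ∑ e ∈ Finset.univ.filter (fun e : Edge n => tgt e = i), edgeDeg Γ e

/-- The distinct prefixes at `i` that occur in the routes of `C`. -/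
def prefixes {n : ℕ} (C : Set (List (Edge n))) (i : ℕ) : Set (List (Edge n)) :=
  {P | IsPath 1 P i ∧ ∃ Q, P ++ Q ∈ C}

/-- The position, counted from `1`, of a prefix among the prefixes at `i` in `C`. -/
noncomputable def prefixPos {n : ℕ} (C : Set (List (Edge n))) (i : ℕ) (P : List (Edge n)) : ℕ :=
  {P' ∈ prefixes C i | PrefixLt P' P}.ncard + 1

/-- The grove of a clique: in the `i`-th tree, left vertices are the prefixes at `i` in `C`, right
vertices are the outgoing edges of `i`, and edges record the pairs that occur in a route of `C`. -/
noncomputable def groveOf {n : ℕ} (C : Set (List (Edge n))) (i : ℕ) : BipGraph where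
  p := (prefixes C i).ncard
  edges := {t | ∃ (P Q : List (Edge n)) (e : Edge n),
    IsPath 1 P i ∧ src e = i ∧ P ++ e :: Q ∈ C ∧ t = (prefixPos C i P, outPos e)}

/-- `m_i^+` applies to the grove `Γ`, and `m_i^+(Γ) = Γ'`. -/
def GroveMovePlus (n i : ℕ) (Γ Γ' : ℕ → BipGraph) : Prop :=
  (∃ j, (j, 1) ∈ (Γ i).edges ∧ (j, 2) ∈ (Γ i).edges ∧ j ≠ 1 ∧
    Γ' i = ⟨(Γ i).p, ((Γ i).edges \ {(j, 1)}) ∪ {(j - 1, 2)}⟩) ∧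
  (i < n - 1 →
    ¬ (((Γ (i + 1)).p, 1) ∈ (Γ (i + 1)).edges ∧ ((Γ (i + 1)).p, 2) ∈ (Γ (i + 1)).edges) ∧
    Γ' (i + 1) = ⟨(Γ (i + 1)).p - 1, {t ∈ (Γ (i + 1)).edges | t.1 ≠ (Γ (i + 1)).p}⟩) ∧
  (i < n - 2 →
    Γ' (i + 2) =
      ⟨(Γ (i + 2)).p + 1, (fun t : ℕ × ℕ => (t.1 + 1, t.2)) '' (Γ (i + 2)).edges ∪ {(1, 1)}⟩) ∧
  ∀ k ∈ inner n, k ≠ i → k ≠ i + 1 → k ≠ i + 2 → Γ' k = Γ k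

/-- `m_i^-`, the inverse operation. -/
def GroveMoveMinus (n i : ℕ) (Γ Γ' : ℕ → BipGraph) : Prop := GroveMovePlus n i Γ' Γ

/-! ### Integer flows -/

/-- The in-degree of a vertex. -/
def indeg (n i : ℕ) : ℕ := (Finset.univ.filter fun e : Edge n => tgt e = i).card

/-- The shifted in-degree vector `(0, d_2, …, d_{n-1}, -∑ d_i)`, where `d_i = indeg i - 1`. -/
def shiftedIndeg (n i : ℕ) : ℤ :=
  if i = 1 then 0
  else if i = n then -∑ j ∈ inner n, ((indeg n j : ℤ) - 1)
  else (indeg n i : ℤ) - 1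

/-- The (nonnegative) integer flows whose net flow is the shifted in-degree vector. -/
def IsIntegerFlow {n : ℕ} (φ : Edge n → ℤ) : Prop :=
  (∀ e, 0 ≤ φ e) ∧
  ∀ i ∈ Finset.Icc 1 n,
    (∑ e ∈ Finset.univ.filter (fun e : Edge n => tgt e = i), φ e) + shiftedIndeg n i =
      ∑ e ∈ Finset.univ.filter (fun e : Edge n => src e = i), φ e

/-- The integer flow of a grove: zero on edges leaving vertex `1`, and otherwise one less than the
degree of the right vertex corresponding to the edge. -/
noncomputable def flowOf {n : ℕ} (Γ : ℕ → BipGraph) (e : Edge n) : ℤ :=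
  if src e = 1 then 0 else ((Γ (src e)).deg (outPos e) : ℤ) - 1

/-- `m_i^+` applies to `φ`: the flows on `x_i` and on `y_{i+1}`, where these edges exist, are
positive. -/
def FlowPlusApplies {n : ℕ} (i : ℕ) (φ : Edge n → ℤ) : Prop :=
  ∀ e, IsX i e ∨ IsY (i + 1) e → 0 < φ e

/-- `m_i^+(φ)`: subtract one on `x_i`, `y_{i+1}` and add one on `x_{i+2}`, `y_i`, where these edges
exist. -/
def flowPlus {n : ℕ} (i : ℕ) (φ : Edge n → ℤ) (e : Edge n) : ℤ :=
  if IsX i e ∨ IsY (i + 1) e then φ e - 1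
  else if IsX (i + 2) e ∨ IsY i e then φ e + 1
  else φ e

/-- `m_i^-` applies to `φ`. -/
def FlowMinusApplies {n : ℕ} (i : ℕ) (φ : Edge n → ℤ) : Prop :=
  ∀ e, IsX (i + 2) e ∨ IsY i e → 0 < φ e

/-- `m_i^-(φ)`: subtract one on `x_{i+2}`, `y_i` and add one on `x_i`, `y_{i+1}`, where these edges
exist. -/
def flowMinus {n : ℕ} (i : ℕ) (φ : Edge n → ℤ) (e : Edge n) : ℤ :=
  if IsX (i + 2) e ∨ IsY i e then φ e - 1
  else if IsX i e ∨ IsY (i + 1) e then φ e + 1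
  else φ e

end CZig

/-! Points with coordinates 0 and 1 are in convex position and a route is determined by its set of
edges, so adjacent simplices come from cliques with `C \ {R} = C' \ {R'}`
(`Adjacent.exists_exchange`). By maximality `R` and `R'` are in conflict. Carried along their common
continuation, the conflict reaches an inner vertex i where, up to swapping the cliques, R = P x_i Z
and R' = P' y_i Z' with P' ≺ P (`exists_conflict`).

The local fact behind everything: in a maximal clique, the prefixes at an inner vertex that are
followed by the slack edge form a lower segment, those followed by the nonslack edge an upper
segment, and the two segments share exactly one branching prefix. Its existence
(`IsMaximalClique.exists_branching`) comes from splicing pieces of routes into a route coherent with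
the whole clique (`IsClique.coherent_splice`). Hence every tree of the grove is a staircase `stair p
j`, and the degree of an edge `e` is the size of `ext C e`.

In the exchange, P and P' turn out to be the branching prefixes of `C` and `C'`, and P x_i, P' y_i
occur in `R`, `R'` only (`exchange_branching`). As long as the vertices concerned are inner, P x_i
is the top prefix at i+1; having a single continuation it does not branch, so it goes on along
y_{i+1}. Dually P' y_i is the bottom prefix at i+2 and goes on along x_{i+2}. The routes meet at
i+3, in the same position among the remaining prefixes, and coincide from there on
(`exchange_tails`, `tail_eq_of_exchange`). So among the slack edges only x_i loses a degree and only
x_{i+2} gains one (`exchange_ncard_ext`).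

Finally deg x_k + deg y_k = deg x_{k-1} + deg y_{k-2} + 1 at inner k propagates this to the nonslack
edges (`SlackMove.nonslack`), and both moves are read off from the degrees. -/

namespace CZig

/-! ### Comparing lists at the first place where they differ -/

/-- `L` and `M` first differ at entries `e`, `e'` with `r e e'`. -/
def DivLt {α : Type*} (r : α → α → Prop) (L M : List α) : Prop :=
  ∃ (S A A' : List α) (e e' : α), L = S ++ e :: A ∧ M = S ++ e' :: A' ∧ r e e'

section DivLt
variable {α : Type*} {r : α → α → Prop}

lemma DivLt.not_nil_left (M : List α) : ¬ DivLt r [] M := by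
  rintro ⟨S, A, A', e, e', h, -⟩
  simp at h

lemma DivLt.not_nil_right (L : List α) : ¬ DivLt r L [] := by
  rintro ⟨S, A, A', e, e', -, h, -⟩
  simp at h

lemma divLt_cons_cons {a b : α} {L M : List α} :
    DivLt r (a :: L) (b :: M) ↔ r a b ∨ (a = b ∧ DivLt r L M) := by
  constructor
  · rintro ⟨S, A, A', e, e', h, h', hr⟩
    cases S with
    | nil =>
      simp only [List.nil_append, List.cons.injEq] at h h'
      left; rw [h.1, h'.1]; exact hr
    | cons s S =>
      simp only [List.cons_append, List.cons.injEq] at h h'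
      exact Or.inr ⟨h.1.trans h'.1.symm, S, A, A', e, e', h.2, h'.2, hr⟩
  · rintro (h | ⟨rfl, S, A, A', e, e', h, h', hr⟩)
    · exact ⟨[], L, M, a, b, rfl, rfl, h⟩
    · exact ⟨a :: S, A, A', e, e', by simp [h], by simp [h'], hr⟩

lemma DivLt.irrefl (hr : ∀ a, ¬ r a a) (L : List α) : ¬ DivLt r L L := by
  induction L with
  | nil => exact DivLt.not_nil_left _
  | cons a L ih => simp [divLt_cons_cons, hr, ih]

lemma DivLt.trans (hr : ∀ a b c, r a b → r b c → r a c) {L M N : List α}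
    (h : DivLt r L M) (h' : DivLt r M N) : DivLt r L N := by
  induction L generalizing M N with
  | nil => exact absurd h (DivLt.not_nil_left _)
  | cons a L ih =>
    cases M with
    | nil => exact absurd h' (DivLt.not_nil_left _)
    | cons b M =>
      cases N with
      | nil => exact absurd h' (DivLt.not_nil_right _)
      | cons c N =>
        rw [divLt_cons_cons] at *
        rcases h with h | ⟨rfl, h⟩
        · rcases h' with h' | ⟨rfl, h'⟩
          · exact Or.inl (hr _ _ _ h h')
          · exact Or.inl h
        · rcases h' with h' | ⟨rfl, h'⟩
          · exact Or.inl h'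
          · exact Or.inr ⟨rfl, ih h h'⟩

lemma divLt_append_left (hr : ∀ a, ¬ r a a) (S L M : List α) :
    DivLt r (S ++ L) (S ++ M) ↔ DivLt r L M := by
  induction S with
  | nil => rfl
  | cons a S ih => simp [divLt_cons_cons, hr, ih]

lemma DivLt.swap {L M : List α} : DivLt (fun a b => r b a) L M ↔ DivLt r M L := by
  constructor <;> rintro ⟨S, A, A', e, e', h, h', hr⟩ <;> exact ⟨S, A', A, e', e, h', h, hr⟩

/-- A first difference inside `M` does not see what follows `M`. For spliced routes this means that
a conflict is either inherited from a route of the clique or can be moved to the splicing vertex. -/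
lemma DivLt.append_right_cases {L M Z : List α} (h : DivLt r L (M ++ Z)) :
    (∃ B, L = M ++ B ∧ DivLt r B Z) ∨ ∀ Z', DivLt r L (M ++ Z') := by
  obtain ⟨S, A, A', e, e', hL, hM, he⟩ := h
  rcases List.append_eq_append_iff.1 hM with ⟨K, hK, hK'⟩ | ⟨K, hK, hK'⟩
  · left
    refine ⟨K ++ e :: A, by rw [hL, hK, List.append_assoc], ?_⟩
    rw [hK']
    exact ⟨K, A, A', e, e', rfl, rfl, he⟩
  · cases K with
    | nil =>
      left
      refine ⟨e :: A, by rw [hL, hK]; simp, ?_⟩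
      simp only [List.nil_append] at hK'
      rw [← hK']
      exact ⟨[], A, A', e, e', rfl, rfl, he⟩
    | cons k K =>
      right
      intro Z'
      simp only [List.cons_append, List.cons.injEq] at hK'
      refine ⟨S, A, K ++ Z', e, e', hL, ?_, he⟩
      rw [hK, hK'.1]; simp

lemma DivLt.append_left_cases {L M Z : List α} (h : DivLt r (M ++ Z) L) :
    (∃ B, L = M ++ B ∧ DivLt r Z B) ∨ ∀ Z', DivLt r (M ++ Z') L := by
  have := DivLt.append_right_cases (r := fun a b => r b a) (DivLt.swap.2 h)
  simpa only [DivLt.swap] using this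

end DivLt

/-- A nonempty finite set has an element with no smaller one, for a strict order. -/
lemma exists_not_rel_of_finite {α : Type*} {r : α → α → Prop} (hr : ∀ a, ¬ r a a)
    (ht : ∀ a b c, r a b → r b c → r a c) {s : Set α} (hs : s.Finite) (hne : s.Nonempty) :
    ∃ m ∈ s, ∀ x ∈ s, ¬ r x m := by
  -- Take an element with the fewest elements of `s` below it; anything below it would have strictly
  -- fewer.
  obtain ⟨m, hm, hmin⟩ := Set.exists_min_image s (fun x => {y ∈ s | r y x}.ncard) hs hne
  refine ⟨m, hm, fun x hx hxm => ?_⟩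
  have hlt : {y ∈ s | r y x}.ncard < {y ∈ s | r y m}.ncard := by
    apply Set.ncard_lt_ncard _ (hs.subset (Set.sep_subset _ _))
    refine ⟨fun y hy => ⟨hy.1, ht _ _ _ hy.2 hxm⟩, fun h => hr x (h ⟨hx, hxm⟩).2⟩
  exact absurd (hmin x hx) (not_le.2 hlt)

/-! ### Edges and paths -/

variable {n : ℕ}

lemma IsX.src_eq {i : ℕ} {e : Edge n} (h : IsX i e) : src e = i := by
  rcases e with k | k
  · exact h
  · exact h.elim

lemma IsX.tgt_eq {i : ℕ} {e : Edge n} (h : IsX i e) : tgt e = i + 1 := by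
  rcases e with k | k
  · simp only [IsX] at h; simp only [tgt]; omega
  · exact h.elim

lemma IsX.bounds {i : ℕ} {e : Edge n} (h : IsX i e) : 1 ≤ i ∧ i ≤ n - 1 := by
  rcases e with k | k
  · simp only [IsX] at h; have := k.2; omega
  · exact h.elim

lemma IsX.isLeft {i : ℕ} {e : Edge n} (h : IsX i e) : e.isLeft := by
  rcases e with k | k
  · rfl
  · exact h.elim

lemma IsX.unique {i : ℕ} {e e' : Edge n} (h : IsX i e) (h' : IsX i e') : e = e' := by
  rcases e with k | k
  · rcases e' with k' | k'
    · simp only [IsX] at h h'; congr 1; ext; omega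
    · exact h'.elim
  · exact h.elim

lemma IsY.src_eq {i : ℕ} {e : Edge n} (h : IsY i e) (hi : 1 ≤ i) : src e = i := by
  rcases e with k | k
  · exact h.elim
  · simp only [IsY] at h; simp only [src]; split_ifs <;> omega

lemma IsY.tgt_eq {i : ℕ} {e : Edge n} (h : IsY i e) (hi : i < n - 1) : tgt e = i + 2 := by
  rcases e with k | k
  · exact h.elim
  · simp only [IsY] at h; simp only [tgt]; split_ifs <;> omega

lemma IsY.tgt_last {e : Edge n} (h : IsY (n - 1) e) : tgt e = n := by
  rcases e with k | k
  · exact h.elim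
  · simp only [IsY] at h; simp only [tgt]; split_ifs; omega

lemma IsY.isRight {i : ℕ} {e : Edge n} (h : IsY i e) : e.isRight := by
  rcases e with k | k
  · exact h.elim
  · rfl

lemma IsY.unique {i : ℕ} {e e' : Edge n} (h : IsY i e) (h' : IsY i e') : e = e' := by
  rcases e with k | k
  · exact h.elim
  · rcases e' with k' | k'
    · exact h'.elim
    · simp only [IsY] at h h'; congr 1; ext; omega

lemma exists_isX {i : ℕ} (h : 1 ≤ i) (h' : i ≤ n - 1) : ∃ e : Edge n, IsX i e :=
  ⟨Sum.inl ⟨i - 1, by omega⟩, by simp only [IsX]; omega⟩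

lemma exists_isY {i : ℕ} (h : i < n) : ∃ e : Edge n, IsY i e := ⟨Sum.inr ⟨i, h⟩, rfl⟩

lemma mem_inner {i : ℕ} : i ∈ inner n ↔ 2 ≤ i ∧ i ≤ n - 1 := Finset.mem_Icc

lemma isX_or_isY_of_src {i : ℕ} (hi : i ∈ inner n) {e : Edge n} (he : src e = i) :
    IsX i e ∨ IsY i e := by
  rw [mem_inner] at hi
  rcases e with k | k
  · exact Or.inl he
  · right
    simp only [src] at he
    simp only [IsY]
    split_ifs at he <;> omega

lemma isX_or_isY_of_tgt {i : ℕ} (hi : i ∈ inner n) {e : Edge n} (he : tgt e = i) :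
    IsX (i - 1) e ∨ IsY (i - 2) e := by
  rw [mem_inner] at hi
  rcases e with k | k
  · left
    simp only [tgt] at he
    simp only [IsX]
    omega
  · right
    simp only [tgt] at he
    simp only [IsY]
    split_ifs at he <;> omega

lemma isX_one_or_isY_of_src {e : Edge n} (he : src e = 1) :
    IsX 1 e ∨ IsY 0 e ∨ IsY 1 e := by
  rcases e with k | k
  · exact Or.inl he
  · right
    simp only [src] at he
    simp only [IsY]
    split_ifs at he <;> omega

lemma one_le_src (e : Edge n) : 1 ≤ src e := by
  rcases e with k | k <;> simp only [src]
  · omega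
  · split_ifs <;> omega

lemma src_lt_tgt (hn : 2 ≤ n) (e : Edge n) : src e < tgt e := by
  rcases e with k | k <;> simp only [src, tgt]
  · omega
  · have := k.2
    split_ifs <;> omega

lemma tgt_le (hn : 2 ≤ n) (e : Edge n) : tgt e ≤ n := by
  rcases e with k | k <;> simp only [tgt]
  · omega
  · have := k.2
    split_ifs <;> omega

lemma outLt_of_isX_isY {i : ℕ} (hi : i ∈ inner n) {e e' : Edge n} (h : IsX i e) (h' : IsY i e') :
    OutLt e e' :=
  ⟨by rw [h.src_eq, h'.src_eq (by rw [mem_inner] at hi; omega)], by rwa [h.src_eq], h.isLeft,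
    h'.isRight⟩

lemma inLt_of_isX_isY {i : ℕ} (hi : i ∈ inner n) {e e' : Edge n} (h : IsY (i - 2) e)
    (h' : IsX (i - 1) e') : InLt e e' := by
  rw [mem_inner] at hi
  have h1 : tgt e = i := by rw [h.tgt_eq (by omega)]; omega
  have h2 : tgt e' = i := by rw [h'.tgt_eq]; omega
  exact ⟨by rw [h1, h2], by rw [h1, mem_inner]; omega, h.isRight, h'.isLeft⟩

lemma InLt.irrefl (e : Edge n) : ¬ InLt e e := by
  rintro ⟨-, -, h, h'⟩
  rcases e with k | k <;> simp at h h'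

lemma InLt.trans (a b c : Edge n) (h : InLt a b) (h' : InLt b c) : InLt a c := by
  obtain ⟨-, -, -, h⟩ := h
  obtain ⟨-, -, h', -⟩ := h'
  rcases b with k | k <;> simp at h h'

lemma OutLt.irrefl (e : Edge n) : ¬ OutLt e e := by
  rintro ⟨-, -, h, h'⟩
  rcases e with k | k <;> simp at h h'

lemma OutLt.trans (a b c : Edge n) (h : OutLt a b) (h' : OutLt b c) : OutLt a c := by
  obtain ⟨-, -, -, h⟩ := h
  obtain ⟨-, -, h', -⟩ := h'
  rcases b with k | k <;> simp at h h'

/-- Reversal turns the last meeting of two prefixes into a first difference, so the facts on `DivLt`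
serve both orders. -/
lemma prefixLt_iff {P P' : List (Edge n)} :
    PrefixLt P P' ↔ DivLt InLt P.reverse P'.reverse := by
  constructor
  · rintro ⟨A, A', S, e, e', rfl, rfl, h⟩
    exact ⟨S.reverse, A.reverse, A'.reverse, e, e', by simp, by simp, h⟩
  · rintro ⟨S, A, A', e, e', h, h', hr⟩
    refine ⟨A.reverse, A'.reverse, S.reverse, e, e', ?_, ?_, hr⟩
    · rw [← List.reverse_reverse P, h]; simp
    · rw [← List.reverse_reverse P', h']; simp

lemma SuffixLt.irrefl (Q : List (Edge n)) : ¬ SuffixLt Q Q := DivLt.irrefl OutLt.irrefl Q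

lemma SuffixLt.trans {Q Q' Q'' : List (Edge n)} (h : SuffixLt Q Q') (h' : SuffixLt Q' Q'') :
    SuffixLt Q Q'' := DivLt.trans OutLt.trans h h'

lemma suffixLt_cons_cons {a b : Edge n} {L M : List (Edge n)} :
    SuffixLt (a :: L) (b :: M) ↔ OutLt a b ∨ (a = b ∧ SuffixLt L M) := divLt_cons_cons

lemma PrefixLt.irrefl (P : List (Edge n)) : ¬ PrefixLt P P := by
  rw [prefixLt_iff]; exact DivLt.irrefl InLt.irrefl _

lemma PrefixLt.trans {P P' P'' : List (Edge n)} (h : PrefixLt P P') (h' : PrefixLt P' P'') :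
    PrefixLt P P'' := by
  rw [prefixLt_iff] at *; exact DivLt.trans InLt.trans h h'

lemma PrefixLt.asymm {P P' : List (Edge n)} (h : PrefixLt P P') : ¬ PrefixLt P' P :=
  fun h' => PrefixLt.irrefl _ (h.trans h')

lemma prefixLt_append_right {P P' : List (Edge n)} (M : List (Edge n)) :
    PrefixLt (P ++ M) (P' ++ M) ↔ PrefixLt P P' := by
  simp only [prefixLt_iff, List.reverse_append]
  exact divLt_append_left InLt.irrefl _ _ _

lemma prefixLt_concat {P P' : List (Edge n)} {e e' : Edge n} :
    PrefixLt (P ++ [e]) (P' ++ [e']) ↔ InLt e e' ∨ (e = e' ∧ PrefixLt P P') := by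
  simp only [prefixLt_iff, List.reverse_append, List.reverse_singleton, List.singleton_append]
  exact divLt_cons_cons

lemma suffixLt_append_left {Q Q' : List (Edge n)} (M : List (Edge n)) :
    SuffixLt (M ++ Q) (M ++ Q') ↔ SuffixLt Q Q' := divLt_append_left OutLt.irrefl _ _ _

lemma isPath_append {a b : ℕ} {P Q : List (Edge n)} :
    IsPath a (P ++ Q) b ↔ ∃ c, IsPath a P c ∧ IsPath c Q b := by
  induction P generalizing a with
  | nil => simp [IsPath]
  | cons e P ih => simp [IsPath, ih, and_assoc]

lemma IsPath.unique {a b b' : ℕ} {P : List (Edge n)} (h : IsPath a P b) (h' : IsPath a P b') :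
    b = b' := by
  induction P generalizing a with
  | nil => exact h.symm.trans h'
  | cons e P ih => exact ih h.2 h'.2

lemma IsPath.append {a b c : ℕ} {P Q : List (Edge n)} (h : IsPath a P b) (h' : IsPath b Q c) :
    IsPath a (P ++ Q) c := isPath_append.2 ⟨b, h, h'⟩

lemma IsPath.right {a b c : ℕ} {P Q : List (Edge n)} (h : IsPath a (P ++ Q) c)
    (h' : IsPath a P b) : IsPath b Q c := by
  obtain ⟨d, h1, h2⟩ := isPath_append.1 h
  rwa [h'.unique h1]

lemma isPath_concat {a b : ℕ} {P : List (Edge n)} {e : Edge n} :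
    IsPath a (P ++ [e]) b ↔ IsPath a P (src e) ∧ tgt e = b := by
  rw [isPath_append]
  constructor
  · rintro ⟨c, h, h', h''⟩
    subst h'
    exact ⟨h, h''⟩
  · rintro ⟨h, h'⟩
    exact ⟨_, h, rfl, h'⟩

lemma IsPath.add_length_le (hn : 2 ≤ n) {a b : ℕ} {P : List (Edge n)} (h : IsPath a P b) :
    a + P.length ≤ b := by
  induction P generalizing a with
  | nil => exact h.le
  | cons e P ih =>
    have := ih h.2
    have h1 := h.1
    have := src_lt_tgt hn e
    simp only [List.length_cons]
    omega

lemma IsPath.eq_nil (hn : 2 ≤ n) {a : ℕ} {P : List (Edge n)} (h : IsPath a P a) : P = [] := by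
  have := h.add_length_le hn
  exact List.eq_nil_of_length_eq_zero (by omega)

lemma IsPath.src_mem (hn : 2 ≤ n) {a b : ℕ} {P : List (Edge n)} (h : IsPath a P b) {e : Edge n}
    (he : e ∈ P) : a ≤ src e ∧ src e < b := by
  induction P generalizing a with
  | nil => simp at he
  | cons f P ih =>
    have h1 := h.1
    have h2 := src_lt_tgt hn f
    have h3 := h.2.add_length_le hn
    rcases List.mem_cons.1 he with rfl | he
    · omega
    · have := ih h.2 he
      omega

lemma finite_isPath (hn : 2 ≤ n) (a b : ℕ) : {P : List (Edge n) | IsPath a P b}.Finite := by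
  refine (List.finite_length_le (Edge n) b).subset fun P hP => ?_
  have := IsPath.add_length_le hn hP
  exact (Nat.le_add_left _ _).trans this

/-- Distinct edges into an inner vertex are comparable. -/
lemma inLt_trichotomy {e e' : Edge n} (h : tgt e = tgt e') (hi : tgt e ∈ inner n) :
    e = e' ∨ InLt e e' ∨ InLt e' e := by
  rcases isX_or_isY_of_tgt hi rfl with h1 | h1 <;>
    rcases isX_or_isY_of_tgt hi h.symm with h2 | h2
  · exact Or.inl (h1.unique h2)
  · exact Or.inr (Or.inr (inLt_of_isX_isY hi h2 h1))
  · exact Or.inr (Or.inl (inLt_of_isX_isY hi h1 h2))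
  · exact Or.inl (h1.unique h2)

lemma prefixLt_trichotomy (hn : 2 ≤ n) {i : ℕ} (hi : i ∈ inner n) {P P' : List (Edge n)}
    (h : IsPath 1 P i) (h' : IsPath 1 P' i) : P = P' ∨ PrefixLt P P' ∨ PrefixLt P' P := by
  induction P using List.reverseRecOn generalizing i P' with
  | nil =>
    simp only [IsPath] at h
    subst h
    exact Or.inl (h'.eq_nil hn).symm
  | append_singleton P e ih =>
    rcases List.eq_nil_or_concat P' with rfl | ⟨P', e', rfl⟩
    · simp only [IsPath] at h'
      rw [mem_inner] at hi
      omega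
    · rw [List.concat_eq_append] at *
      rw [isPath_concat] at h h'
      rcases inLt_trichotomy (h.2.trans h'.2.symm) (by rwa [h.2]) with rfl | hlt | hlt
      -- The descent along equal last edges ends at vertex `1`, which is not inner and has only the
      -- empty prefix.
      · by_cases hs : src e = 1
        · left
          rw [hs] at h h'
          rw [h.1.eq_nil hn, h'.1.eq_nil hn]
        · have h1 := one_le_src e
          have h2 := src_lt_tgt hn e
          have hs' : src e ∈ inner n := by rw [mem_inner] at *; omega
          rcases ih hs' h.1 h'.1 with rfl | hlt | hlt
          · exact Or.inl rfl
          · exact Or.inr (Or.inl (prefixLt_concat.2 (Or.inr ⟨rfl, hlt⟩)))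
          · exact Or.inr (Or.inr (prefixLt_concat.2 (Or.inr ⟨rfl, hlt⟩)))
      · exact Or.inr (Or.inl (prefixLt_concat.2 (Or.inl hlt)))
      · exact Or.inr (Or.inr (prefixLt_concat.2 (Or.inl hlt)))

/-! ### Coherence and splicing of routes -/

lemma PrefixLt.append_left_cases {U M X : List (Edge n)} (h : PrefixLt (U ++ M) X) :
    (∃ A, X = A ++ M ∧ PrefixLt U A) ∨ ∀ U', PrefixLt (U' ++ M) X := by
  simp only [prefixLt_iff, List.reverse_append] at h ⊢
  rcases h.append_left_cases with ⟨B, hB, h⟩ | h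
  · left
    exact ⟨B.reverse, by rw [← List.reverse_reverse X, hB]; simp, by simpa using h⟩
  · exact Or.inr fun U' => h _

lemma PrefixLt.append_right_cases {U M X : List (Edge n)} (h : PrefixLt X (U ++ M)) :
    (∃ A, X = A ++ M ∧ PrefixLt A U) ∨ ∀ U', PrefixLt X (U' ++ M) := by
  simp only [prefixLt_iff, List.reverse_append] at h ⊢
  rcases h.append_right_cases with ⟨B, hB, h⟩ | h
  · left
    exact ⟨B.reverse, by rw [← List.reverse_reverse X, hB]; simp, by simpa using h⟩
  · exact Or.inr fun U' => h _

lemma IsPath.append_inj (hn : 2 ≤ n) {i : ℕ} {P Q P' Q' : List (Edge n)} (h : IsPath 1 P i)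
    (h' : IsPath 1 P' i) (heq : P ++ Q = P' ++ Q') : P = P' ∧ Q = Q' := by
  rcases List.append_eq_append_iff.1 heq with ⟨K, rfl, rfl⟩ | ⟨K, rfl, rfl⟩
  · have := (h'.right h).eq_nil hn
    subst this
    simp
  · have := (h.right h').eq_nil hn
    subst this
    simp

lemma Coherent.refl (hn : 2 ≤ n) (R : List (Edge n)) : Coherent R R := by
  rintro i - ⟨P, Q, P', Q', h, h', hP, -, hP', -, hc⟩
  obtain ⟨rfl, rfl⟩ := hP.append_inj hn hP' (h.symm.trans h')
  rcases hc with ⟨h, -⟩ | ⟨h, -⟩ <;> exact PrefixLt.irrefl _ h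

lemma Coherent.symm {R R' : List (Edge n)} (h : Coherent R R') : Coherent R' R := by
  rintro i hi ⟨P, Q, P', Q', h1, h2, h3, h4, h5, h6, hc⟩
  exact h i hi ⟨P', Q', P, Q, h2, h1, h5, h6, h3, h4, hc.symm⟩

lemma IsClique.not_suffixLt {C : Set (List (Edge n))} (hC : IsClique C) {i : ℕ}
    (hi : i ∈ inner n) {P Q P' Q' : List (Edge n)} (h : P ++ Q ∈ C) (h' : P' ++ Q' ∈ C)
    (hP : IsPath 1 P i) (hP' : IsPath 1 P' i) (hlt : PrefixLt P P') : ¬ SuffixLt Q' Q :=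
  fun hlt' => hC.2 _ h _ h' i hi ⟨P, Q, P', Q', rfl, rfl, hP, (hC.1 _ h).right hP, hP',
    (hC.1 _ h').right hP', Or.inl ⟨hlt, hlt'⟩⟩

lemma IsPath.source_unique {b c v : ℕ} {M : List (Edge n)} (h : IsPath b M v)
    (h' : IsPath c M v) : b = c := by
  cases M with
  | nil => exact Eq.trans h h'.symm
  | cons e M => exact h.1.symm.trans h'.1

lemma IsPath.ne_target {a : ℕ} (hn : 2 ≤ n) {Q : List (Edge n)} (h : IsPath a Q n)
    (hne : Q ≠ []) : a ≠ n := by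
  rintro rfl
  exact hne (h.eq_nil hn)

lemma IsPath.ne_source {a : ℕ} (hn : 2 ≤ n) {P : List (Edge n)} (h : IsPath 1 P a)
    (hne : P ≠ []) : a ≠ 1 := by
  rintro rfl
  exact hne (h.eq_nil hn)

lemma DivLt.ne_nil_left {α : Type*} {r : α → α → Prop} {L M : List α} (h : DivLt r L M) :
    L ≠ [] := by
  rintro rfl
  exact DivLt.not_nil_left _ h

lemma DivLt.ne_nil_right {α : Type*} {r : α → α → Prop} {L M : List α} (h : DivLt r L M) :
    M ≠ [] := by
  rintro rfl
  exact DivLt.not_nil_right _ h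

lemma PrefixLt.ne_nil {P P' : List (Edge n)} (h : PrefixLt P P') : P ≠ [] ∧ P' ≠ [] := by
  rw [prefixLt_iff] at h
  exact ⟨fun h' => h.ne_nil_left (by simp [h']), fun h' => h.ne_nil_right (by simp [h'])⟩

/-- A route that starts like a route of the clique `C`, ends like a route of `C` and in between
avoids the vertices visited by `C`, is coherent with `C` as soon as it has no conflict at the
vertices where it leaves and joins. -/
lemma IsClique.coherent_splice (hn : 2 ≤ n) {C : Set (List (Edge n))} (hC : IsClique C) {a b : ℕ}
    {P S W Q₁ P₂ : List (Edge n)} (hP : IsPath 1 P a) (hS : IsPath a S b) (hW : IsPath b W n)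
    (h1 : P ++ Q₁ ∈ C) (hP₂ : IsPath 1 P₂ b) (h2 : P₂ ++ W ∈ C)
    (hint : ∀ K K', S = K ++ K' → K ≠ [] → K' ≠ [] → ∀ v, IsPath a K v →
      ∀ A B, A ++ B ∈ C → ¬ IsPath 1 A v)
    (ha : a ∈ inner n → ∀ A B, A ++ B ∈ C → IsPath 1 A a →
      (PrefixLt A P → ¬ SuffixLt (S ++ W) B) ∧ (PrefixLt P A → ¬ SuffixLt B (S ++ W)))
    (hb : b ∈ inner n → ∀ A B, A ++ B ∈ C → IsPath 1 A b →
      (PrefixLt A (P ++ S) → ¬ SuffixLt W B) ∧ (PrefixLt (P ++ S) A → ¬ SuffixLt B W)) :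
    ∀ T ∈ C, Coherent (P ++ S ++ W) T := by
  rintro T hT v hv ⟨X, Y, X', Y', hN, rfl, hX, hY, hX', hY', hconf⟩
  have hv' := mem_inner.1 hv
  have hSW := hS.append hW
  -- Conflict at or before `a`: if the suffixes diverge before `a`, then `P ++ Q₁` has the same
  -- conflict; otherwise the conflict passes on to `a`, where `ha` excludes it.
  have hbefore : ∀ K, P = X ++ K → Y = K ++ (S ++ W) → False := by
    rintro K rfl rfl
    have hK := hP.right hX
    have hle := hK.add_length_le hn
    have key : ∀ B, Y' = K ++ B → S ++ W ≠ [] → a ∈ inner n ∧ (X' ++ K) ++ B ∈ C ∧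
        IsPath 1 (X' ++ K) a := by
      rintro B rfl hne
      have h3 := hSW.ne_target hn hne
      have h4 := hSW.add_length_le hn
      exact ⟨mem_inner.2 (by omega), by simpa using hT, hX'.append hK⟩
    rw [List.append_assoc] at h1
    rcases hconf with ⟨hlt, hlt'⟩ | ⟨hlt, hlt'⟩
    · rcases DivLt.append_right_cases hlt' with ⟨B, hB, hlt''⟩ | hall
      · obtain ⟨k1, k2, k3⟩ := key B hB hlt''.ne_nil_right
        exact (ha k1 _ _ k2 k3).2 ((prefixLt_append_right K).2 hlt) hlt''
      · exact hC.not_suffixLt hv h1 hT hX hX' hlt (hall Q₁)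
    · rcases DivLt.append_left_cases hlt' with ⟨B, hB, hlt''⟩ | hall
      · obtain ⟨k1, k2, k3⟩ := key B hB hlt''.ne_nil_left
        exact (ha k1 _ _ k2 k3).1 ((prefixLt_append_right K).2 hlt) hlt''
      · exact hC.not_suffixLt hv hT h1 hX' hX hlt (hall Q₁)
  -- Dually at or after `b`: if the prefixes come together after `b`, then `P₂ ++ W` has the same
  -- conflict; otherwise the conflict passes back to `b`.
  have hafter : ∀ M, X = P ++ S ++ M → W = M ++ Y → False := by
    rintro M rfl rfl
    have hM : IsPath b M v := hX.right (hP.append hS)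
    have hle := hM.add_length_le hn
    have key : ∀ A, X' = A ++ M → P ++ S ≠ [] → b ∈ inner n ∧ A ++ (M ++ Y') ∈ C ∧
        IsPath 1 A b := by
      rintro A rfl hne
      obtain ⟨c, h3, h4⟩ := isPath_append.1 hX'
      have h5 := hM.source_unique h4
      subst h5
      have h6 := h3.add_length_le hn
      have h7 := (hP.append hS).ne_source hn hne
      exact ⟨mem_inner.2 (by omega), by simpa using hT, h3⟩
    rw [← List.append_assoc] at h2
    rcases hconf with ⟨hlt, hlt'⟩ | ⟨hlt, hlt'⟩
    · rcases hlt.append_left_cases with ⟨A, hA, hlt''⟩ | hall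
      · obtain ⟨k1, k2, k3⟩ := key A hA hlt''.ne_nil.1
        exact (hb k1 _ _ k2 k3).2 hlt'' ((suffixLt_append_left M).2 hlt')
      · exact hC.not_suffixLt hv h2 hT (hP₂.append hM) hX' (hall P₂) hlt'
    · rcases hlt.append_right_cases with ⟨A, hA, hlt''⟩ | hall
      · obtain ⟨k1, k2, k3⟩ := key A hA hlt''.ne_nil.2
        exact (hb k1 _ _ k2 k3).1 hlt'' ((suffixLt_append_left M).2 hlt')
      · exact hC.not_suffixLt hv hT h2 hX' (hP₂.append hM) (hall P₂) hlt'
  rw [List.append_assoc] at hN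
  rcases List.append_eq_append_iff.1 hN with ⟨K, h3, h4⟩ | ⟨K, h3, h4⟩
  · rcases List.append_eq_append_iff.1 h4 with ⟨M, rfl, h6⟩ | ⟨K', h5, h6⟩
    · exact hafter M (by rw [h3, List.append_assoc]) h6
    · by_cases hK : K = []
      · subst hK
        exact hbefore [] (by simp [h3]) (by simpa using h4.symm)
      by_cases hK' : K' = []
      · subst hK'
        exact hafter [] (by simp [h3, h5]) (by simpa using h6.symm)
      subst h3
      exact hint K K' h5 hK hK' v (hX.right hP) X' Y' hT hX'
  · exact hbefore K h3 h4

lemma IsMaximalClique.mem_of_coherent (hn : 2 ≤ n) {C : Set (List (Edge n))}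
    (hC : IsMaximalClique C) {N : List (Edge n)} (hN : IsRoute N) (h : ∀ T ∈ C, Coherent N T) :
    N ∈ C := by
  have hcl : IsClique (insert N C) := by
    refine ⟨?_, ?_⟩
    · rintro R (rfl | hR)
      · exact hN
      · exact hC.1.1 R hR
    · rintro R (rfl | hR) R' (rfl | hR')
      · exact Coherent.refl hn _
      · exact h _ hR'
      · exact (h _ hR).symm
      · exact hC.1.2 R hR R' hR'
  exact hC.2 hcl (Set.subset_insert _ _) (Set.mem_insert _ _)

/-! ### A maximal clique uses all vertices and edges -/

/-- Some route of `C` passes through the vertex `v`. -/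
def Visits (C : Set (List (Edge n))) (v : ℕ) : Prop := ∃ P Q, P ++ Q ∈ C ∧ IsPath 1 P v

lemma finite_prefixes (hn : 2 ≤ n) (C : Set (List (Edge n))) (i : ℕ) : (prefixes C i).Finite :=
  (finite_isPath hn 1 i).subset fun _ h => h.1

/-- The suffixes at `i` that occur in the routes of `C`. -/
def suffixes (C : Set (List (Edge n))) (i : ℕ) : Set (List (Edge n)) :=
  {Q | IsPath i Q n ∧ ∃ P, IsPath 1 P i ∧ P ++ Q ∈ C}

lemma finite_suffixes (hn : 2 ≤ n) (C : Set (List (Edge n))) (i : ℕ) : (suffixes C i).Finite :=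
  (finite_isPath hn i n).subset fun _ h => h.1

lemma IsClique.visits_nonempty {C : Set (List (Edge n))} (hC : IsClique C) {v : ℕ}
    (h : Visits C v) : (prefixes C v).Nonempty ∧ (suffixes C v).Nonempty := by
  obtain ⟨P, Q, h, hP⟩ := h
  exact ⟨⟨P, hP, Q, h⟩, ⟨Q, (hC.1 _ h).right hP, P, hP, h⟩⟩

lemma exists_min_prefix {s : Set (List (Edge n))} (hs : s.Finite)
    (h : s.Nonempty) : ∃ P ∈ s, ∀ A ∈ s, ¬ PrefixLt A P :=
  exists_not_rel_of_finite PrefixLt.irrefl (fun _ _ _ h h' => h.trans h') hs h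

lemma exists_max_prefix {s : Set (List (Edge n))} (hs : s.Finite)
    (h : s.Nonempty) : ∃ P ∈ s, ∀ A ∈ s, ¬ PrefixLt P A :=
  exists_not_rel_of_finite (r := fun P Q => PrefixLt Q P) PrefixLt.irrefl
    (fun _ _ _ h h' => h'.trans h) hs h

lemma exists_min_suffix {s : Set (List (Edge n))} (hs : s.Finite)
    (h : s.Nonempty) : ∃ P ∈ s, ∀ A ∈ s, ¬ SuffixLt A P :=
  exists_not_rel_of_finite SuffixLt.irrefl (fun _ _ _ h h' => h.trans h') hs h

lemma exists_max_suffix {s : Set (List (Edge n))} (hs : s.Finite)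
    (h : s.Nonempty) : ∃ P ∈ s, ∀ A ∈ s, ¬ SuffixLt P A :=
  exists_not_rel_of_finite (r := fun P Q => SuffixLt Q P) SuffixLt.irrefl
    (fun _ _ _ h h' => h'.trans h) hs h

lemma IsPath.exists_cons {a b : ℕ} {Q : List (Edge n)} (h : IsPath a Q b) (hab : a ≠ b) :
    ∃ g Q', Q = g :: Q' ∧ src g = a ∧ IsPath (tgt g) Q' b := by
  cases Q with
  | nil => exact absurd h hab
  | cons g Q' => exact ⟨g, Q', rfl, h.1, h.2⟩

lemma IsPath.exists_concat {a b : ℕ} {Q : List (Edge n)} (h : IsPath a Q b) (hab : a ≠ b) :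
    ∃ Q' g, Q = Q' ++ [g] ∧ IsPath a Q' (src g) ∧ tgt g = b := by
  rcases List.eq_nil_or_concat Q with rfl | ⟨Q', g, rfl⟩
  · exact absurd h hab
  · rw [List.concat_eq_append, isPath_concat] at h
    exact ⟨Q', g, by simp, h⟩

/-- Join the lowest prefix at `a` to the highest suffix at `b` by `S`. A slack edge is the lowest
way out of `a` and the highest way into `b`, so if `e` and `f` were both unused, the new route would
be coherent with `C`. Taking `e = f` gives single edges; two distinct ends allow a path through an
unvisited vertex. -/
lemma IsMaximalClique.uses_slack_path (hn : 2 ≤ n) {C : Set (List (Edge n))}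
    (hC : IsMaximalClique C) {a b : ℕ} {S S₁ S₂ : List (Edge n)} {e f : Edge n}
    (hS : IsPath a S b) (hhead : S = e :: S₁) (hlast : S = S₂ ++ [f]) (he : e.isLeft)
    (hf : f.isLeft) (ha : Visits C a) (hb : Visits C b)
    (hint : ∀ K K', S = K ++ K' → K ≠ [] → K' ≠ [] → ∀ v, IsPath a K v →
      ∀ A B, A ++ B ∈ C → ¬ IsPath 1 A v) : (∃ R ∈ C, e ∈ R) ∨ ∃ R ∈ C, f ∈ R := by
  by_contra! hcon
  obtain ⟨hce, hcf⟩ := hcon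
  obtain ⟨P, ⟨hP, Q₁, h1⟩, hPmin⟩ := exists_min_prefix (finite_prefixes hn C a)
    (hC.1.visits_nonempty ha).1
  obtain ⟨W, ⟨hW, P₂, hP₂, h2⟩, hWmax⟩ := exists_max_suffix (finite_suffixes hn C b)
    (hC.1.visits_nonempty hb).2
  refine hce (P ++ S ++ W) (hC.mem_of_coherent hn ((hP.append hS).append hW) ?_) (by simp [hhead])
  refine hC.1.coherent_splice hn hP hS hW h1 hP₂ h2 hint ?_ ?_
  · intro hia A B hAB hA
    refine ⟨fun h => absurd h (hPmin A ⟨hA, B, hAB⟩), fun _ h => ?_⟩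
    rw [mem_inner] at hia
    obtain ⟨g, B', rfl, hg, -⟩ := ((hC.1.1 _ hAB).right hA).exists_cons (by omega)
    rw [hhead, List.cons_append, suffixLt_cons_cons] at h
    rcases h with h | ⟨rfl, -⟩
    · have := h.2.2.2
      rcases e with k | k <;> simp at he this
    · exact hce _ hAB (by simp)
  · intro hib A B hAB hA
    refine ⟨fun _ => hWmax B ⟨(hC.1.1 _ hAB).right hA, A, hA, hAB⟩, fun h _ => ?_⟩
    rw [mem_inner] at hib
    obtain ⟨A', g, rfl, hA', hg⟩ := hA.exists_concat (by omega)
    rw [hlast, ← List.append_assoc, prefixLt_concat] at h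
    rcases h with h | ⟨rfl, -⟩
    · have := h.2.2.1
      rcases f with k | k <;> simp at hf this
    · exact hcf _ hAB (by simp)

/-- The mirror image of `uses_slack_path`: a nonslack edge is the highest way out and the lowest way
in, so it joins the highest prefix to the lowest suffix. -/
lemma IsMaximalClique.uses_nonslack (hn : 2 ≤ n) {C : Set (List (Edge n))}
    (hC : IsMaximalClique C) {e : Edge n} (he : e.isRight) (ha : Visits C (src e))
    (hb : Visits C (tgt e)) : ∃ R ∈ C, e ∈ R := by
  by_contra! hce
  obtain ⟨P, ⟨hP, Q₁, h1⟩, hPmax⟩ := exists_max_prefix (finite_prefixes hn C (src e))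
    (hC.1.visits_nonempty ha).1
  obtain ⟨W, ⟨hW, P₂, hP₂, h2⟩, hWmin⟩ := exists_min_suffix (finite_suffixes hn C (tgt e))
    (hC.1.visits_nonempty hb).2
  have hS : IsPath (src e) [e] (tgt e) := ⟨rfl, rfl⟩
  refine hce (P ++ [e] ++ W) (hC.mem_of_coherent hn ((hP.append hS).append hW) ?_) (by simp)
  refine hC.1.coherent_splice hn hP hS hW h1 hP₂ h2 ?_ ?_ ?_
  · intro K K' hK hne hne'
    have := congrArg List.length hK
    have h1 := List.length_pos_iff.2 hne
    have h2 := List.length_pos_iff.2 hne'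
    simp only [List.length_append, List.length_singleton] at this
    omega
  · intro hia A B hAB hA
    refine ⟨fun _ h => ?_, fun h => absurd h (hPmax A ⟨hA, B, hAB⟩)⟩
    rw [mem_inner] at hia
    obtain ⟨g, B', rfl, hg, -⟩ := ((hC.1.1 _ hAB).right hA).exists_cons (by omega)
    rw [List.cons_append, suffixLt_cons_cons] at h
    rcases h with h | ⟨rfl, -⟩
    · have := h.2.2.1
      rcases e with k | k <;> simp at he this
    · exact hce _ hAB (by simp)
  · intro hib A B hAB hA
    refine ⟨fun h _ => ?_, fun _ => hWmin B ⟨(hC.1.1 _ hAB).right hA, A, hA, hAB⟩⟩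
    rw [mem_inner] at hib
    obtain ⟨A', g, rfl, hA', hg⟩ := hA.exists_concat (by omega)
    rw [prefixLt_concat] at h
    rcases h with h | ⟨rfl, -⟩
    · have := h.2.2.2
      rcases e with k | k <;> simp at he this
    · exact hce _ hAB (by simp)

lemma exists_isPath_target {v : ℕ} (hv : 1 ≤ v) (hvn : v ≤ n) :
    ∃ Q : List (Edge n), IsPath v Q n := by
  induction hvn using Nat.decreasingInduction with
  | self => exact ⟨[], rfl⟩
  | of_succ k hk ih =>
    obtain ⟨Q, hQ⟩ := ih (by omega)
    obtain ⟨e, he⟩ := exists_isX (n := n) hv (by omega)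
    exact ⟨e :: Q, he.src_eq, by rwa [he.tgt_eq]⟩

lemma IsMaximalClique.nonempty (hn : 2 ≤ n) {C : Set (List (Edge n))}
    (hC : IsMaximalClique C) : C.Nonempty := by
  obtain ⟨N, hN⟩ := exists_isPath_target (n := n) (v := 1) le_rfl (by omega)
  by_contra hne
  rw [Set.not_nonempty_iff_eq_empty] at hne
  have := hC.mem_of_coherent hn hN (by simp [hne])
  simp [hne] at this

lemma IsRoute.exists_split {R : List (Edge n)} (hR : IsRoute R) {e : Edge n} (he : e ∈ R) :
    ∃ A B, R = A ++ e :: B ∧ IsPath 1 A (src e) ∧ IsPath (tgt e) B n := by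
  obtain ⟨A, B, rfl⟩ := List.append_of_mem he
  obtain ⟨c, h1, h2⟩ := isPath_append.1 hR
  have h3 : src e = c := h2.1
  subst h3
  exact ⟨A, B, rfl, h1, h2.2⟩

/-- If `i` is visited but `i + 1 < n` is not, then the routes through `i` jump to `i + 2`, and
`uses_slack_path` applied to x_i x_{i+1} yields a route through `i + 1` after all. -/
lemma IsMaximalClique.visits (hn : 2 ≤ n) {C : Set (List (Edge n))}
    (hC : IsMaximalClique C) {v : ℕ} (hv : 1 ≤ v) (hvn : v ≤ n) : Visits C v := by
  induction v, hv using Nat.le_induction with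
  | base =>
    obtain ⟨R, hR⟩ := hC.nonempty hn
    exact ⟨[], R, hR, rfl⟩
  | succ i hi ih =>
    have ihv := ih (by omega)
    by_contra hnot
    rcases Nat.lt_or_ge (i + 1) n with hlt | hge
    swap
    · obtain ⟨R, hR⟩ := hC.nonempty hn
      have : i + 1 = n := by omega
      exact hnot ⟨R, [], by simpa using hR, this ▸ hC.1.1 R hR⟩
    obtain ⟨e, he⟩ := exists_isX (n := n) hi (by omega)
    obtain ⟨f, hf⟩ := exists_isX (n := n) (i := i + 1) (by omega) (by omega)
    have hb : Visits C (i + 2) := by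
      obtain ⟨P, Q, h, hP⟩ := ihv
      obtain ⟨g, Q', rfl, hg, -⟩ := ((hC.1.1 _ h).right hP).exists_cons (by omega)
      have hpath : IsPath 1 (P ++ [g]) (tgt g) := isPath_concat.2 ⟨hg ▸ hP, rfl⟩
      have hmem : (P ++ [g]) ++ Q' ∈ C := by simpa using h
      have hne : tgt g ≠ i + 1 := fun h' => hnot ⟨_, _, hmem, h' ▸ hpath⟩
      refine ⟨_, _, hmem, ?_⟩
      suffices tgt g = i + 2 by rwa [this] at hpath
      -- Vertex `1` is special: `y_0` is a third outgoing edge, and it ends at `2` as well.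
      rcases Nat.lt_or_ge i 2 with h2 | h2
      · obtain rfl : i = 1 := by omega
        rcases isX_one_or_isY_of_src hg with h' | h' | h'
        · exact absurd h'.tgt_eq hne
        · exact absurd (h'.tgt_eq (by omega)) hne
        · exact h'.tgt_eq (by omega)
      · rcases isX_or_isY_of_src (mem_inner.2 (by omega)) hg with h' | h'
        · exact absurd h'.tgt_eq hne
        · exact h'.tgt_eq (by omega)
    have hS : IsPath i [e, f] (i + 2) :=
      ⟨he.src_eq, by rw [hf.src_eq, he.tgt_eq], hf.tgt_eq⟩
    have hvis : ∀ R ∈ C, ∀ P Q, R = P ++ Q → ¬ IsPath 1 P (i + 1) := fun R hR P Q h hP =>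
      hnot ⟨P, Q, h ▸ hR, hP⟩
    have hint : ∀ K K', [e, f] = K ++ K' → K ≠ [] → K' ≠ [] → ∀ v, IsPath i K v →
        ∀ A B, A ++ B ∈ C → ¬ IsPath 1 A v := by
      intro K K' hK hne hne' v hv A B hAB hA
      obtain ⟨k, K, rfl⟩ := List.exists_cons_of_ne_nil hne
      simp only [List.cons_append, List.cons.injEq] at hK
      obtain ⟨rfl, hK⟩ := hK
      have : K = [] := by
        have h1 := congrArg List.length hK
        have h2 := List.length_pos_iff.2 hne'
        simp only [List.length_append, List.length_singleton] at h1
        exact List.eq_nil_of_length_eq_zero (by omega)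
      subst this
      have hv' : tgt e = v := hv.2
      rw [he.tgt_eq] at hv'
      subst hv'
      exact hnot ⟨A, B, hAB, hA⟩
    rcases hC.uses_slack_path hn hS rfl (S₂ := [e]) (f := f) rfl he.isLeft hf.isLeft ihv hb hint
      with ⟨R, hR, hmem⟩ | ⟨R, hR, hmem⟩
    · obtain ⟨A, B, h, hA, hB⟩ := (hC.1.1 R hR).exists_split hmem
      refine hvis R hR (A ++ [e]) B (by simp [h]) (isPath_concat.2 ⟨hA, he.tgt_eq⟩)
    · obtain ⟨A, B, h, hA, hB⟩ := (hC.1.1 R hR).exists_split hmem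
      rw [hf.src_eq] at hA
      exact hvis R hR A _ h hA

lemma IsMaximalClique.uses_edge (hn : 2 ≤ n) {C : Set (List (Edge n))}
    (hC : IsMaximalClique C) (e : Edge n) : ∃ R ∈ C, e ∈ R := by
  have h1 := one_le_src e
  have h2 := src_lt_tgt hn e
  have h3 := tgt_le hn e
  have ha := hC.visits hn h1 (by omega)
  have hb := hC.visits hn (v := tgt e) (by omega) h3
  rcases Bool.eq_false_or_eq_true e.isLeft with he | he
  · have := hC.uses_slack_path hn (S := [e]) (S₁ := []) (S₂ := []) (e := e) (f := e) ⟨rfl, rfl⟩ rfl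
      rfl he he ha hb ?_
    · simpa using this
    · intro K K' hK hne hne'
      have := congrArg List.length hK
      have h1 := List.length_pos_iff.2 hne
      have h2 := List.length_pos_iff.2 hne'
      simp only [List.length_append, List.length_singleton] at this
      omega
  · exact hC.uses_nonslack hn (by rcases e with k | k <;> simp at he ⊢) ha hb

/-! ### The prefixes in front of an edge -/

/-- The prefixes at the source of `e` that are followed by `e` in a route of `C`. -/
def ext (C : Set (List (Edge n))) (e : Edge n) : Set (List (Edge n)) :=
  {P | IsPath 1 P (src e) ∧ ∃ Q, P ++ e :: Q ∈ C}

lemma finite_ext (hn : 2 ≤ n) (C : Set (List (Edge n))) (e : Edge n) : (ext C e).Finite :=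
  (finite_isPath hn 1 _).subset fun _ h => h.1

lemma IsMaximalClique.ext_nonempty (hn : 2 ≤ n) {C : Set (List (Edge n))}
    (hC : IsMaximalClique C) (e : Edge n) : (ext C e).Nonempty := by
  obtain ⟨R, hR, he⟩ := hC.uses_edge hn e
  obtain ⟨A, B, rfl, hA, hB⟩ := (hC.1.1 R hR).exists_split he
  exact ⟨A, hA, B, hR⟩

/-- Suffixes starting with `x` lie below those starting with `y`, so coherence forces the prefixes
into the same order. This is the noncrossing condition of the tree at `i`. -/
lemma IsClique.ext_noncrossing {C : Set (List (Edge n))} (hC : IsClique C) {i : ℕ}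
    (hi : i ∈ inner n) {x y : Edge n} (hx : IsX i x) (hy : IsY i y) {A B : List (Edge n)}
    (hA : A ∈ ext C y) (hB : B ∈ ext C x) : ¬ PrefixLt A B := by
  intro hlt
  obtain ⟨hA, Q, hQ⟩ := hA
  obtain ⟨hB, Q', hQ'⟩ := hB
  rw [hy.src_eq (by rw [mem_inner] at hi; omega)] at hA
  rw [hx.src_eq] at hB
  exact hC.not_suffixLt hi hQ hQ' hA hB hlt
    (suffixLt_cons_cons.2 (Or.inl (outLt_of_isX_isY hi hx hy)))

/-- In front of an inner vertex, some prefix is followed by both outgoing edges. -/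
lemma IsMaximalClique.exists_branching (hn : 2 ≤ n) {C : Set (List (Edge n))}
    (hC : IsMaximalClique C) {i : ℕ} (hi : i ∈ inner n) {x y : Edge n} (hx : IsX i x)
    (hy : IsY i y) : ∃ J, J ∈ ext C x ∧ J ∈ ext C y := by
  have hi' := mem_inner.1 hi
  have hxs := hx.src_eq
  have hys := hy.src_eq (by omega)
  -- The candidate route consists of the highest prefix followed by `x` and the lowest suffix
  -- starting with `y`. It is a splice with empty middle part, so the conditions at both ends
  -- coincide.
  obtain ⟨P, hPx, hPmax⟩ := exists_max_prefix (finite_ext hn C x) (hC.ext_nonempty hn x)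
  have hne : {W | W ∈ suffixes C i ∧ ∃ Q, W = y :: Q}.Nonempty := by
    obtain ⟨A, hA, Q, hQ⟩ := hC.ext_nonempty hn y
    rw [hys] at hA
    exact ⟨y :: Q, ⟨(hC.1.1 _ hQ).right hA, A, hA, hQ⟩, Q, rfl⟩
  obtain ⟨W, ⟨⟨hW, P₂, hP₂, h2⟩, Q, rfl⟩, hWmin⟩ :=
    exists_min_suffix ((finite_suffixes hn C i).subset fun _ h => h.1) hne
  have hPx' := hPx
  obtain ⟨hP, Q₁, h1⟩ := hPx
  rw [hxs] at hP
  have hbranch : ∀ A B, A ++ B ∈ C → IsPath 1 A i →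
      (PrefixLt A P → ¬ SuffixLt (y :: Q) B) ∧ (PrefixLt P A → ¬ SuffixLt B (y :: Q)) := by
    intro A B hAB hA
    have hB := (hC.1.1 _ hAB).right hA
    obtain ⟨g, B', rfl, hg, -⟩ := hB.exists_cons (by omega)
    rcases isX_or_isY_of_src hi hg with hgx | hgy
    · have := hgx.unique hx
      subst this
      refine ⟨fun _ h => ?_, fun h => absurd h (hPmax A ⟨by rwa [hxs], B', hAB⟩)⟩
      rcases suffixLt_cons_cons.1 h with h | ⟨rfl, -⟩
      · exact OutLt.irrefl _ (OutLt.trans _ _ _ h (outLt_of_isX_isY hi hx hy))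
      · exact OutLt.irrefl _ (outLt_of_isX_isY hi hx hy)
    · have := hgy.unique hy
      subst this
      exact ⟨fun h _ => hC.1.ext_noncrossing hi hx hy ⟨by rwa [hys], B', hAB⟩ hPx' h,
        fun _ => hWmin _ ⟨⟨hB, A, hA, hAB⟩, B', rfl⟩⟩
  refine ⟨P, hPx', by rwa [hys], Q, ?_⟩
  have := hC.1.coherent_splice hn (S := []) hP rfl hW h1 hP₂ h2 ?_ ?_ ?_
  · rw [List.append_nil] at this
    exact hC.mem_of_coherent hn (hP.append hW) this
  · intro K K' hK hne
    simp at hK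
    exact absurd hK.1 hne
  · exact fun _ => hbranch
  · rw [List.append_nil]
    exact fun _ => hbranch

/-! ### Noncrossing trees with two right vertices -/

/-- The noncrossing tree with `p` left vertices in which `r_1` is joined to `l_1, …, l_j` and `r_2`
to `l_j, …, l_p`. -/
def stair (p j : ℕ) : BipGraph :=
  ⟨p, {t | (t.2 = 1 ∧ 1 ≤ t.1 ∧ t.1 ≤ j) ∨ (t.2 = 2 ∧ j ≤ t.1 ∧ t.1 ≤ p)}⟩

lemma stair_deg_one (p j : ℕ) : (stair p j).deg 1 = j := by
  have : {k | (k, 1) ∈ (stair p j).edges} = (Finset.Icc 1 j : Set ℕ) := by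
    ext k; simp [stair]
  rw [BipGraph.deg, this, Set.ncard_coe_finset, Nat.card_Icc]
  omega

lemma stair_deg_two (p j : ℕ) : (stair p j).deg 2 = p + 1 - j := by
  have : {k | (k, 2) ∈ (stair p j).edges} = (Finset.Icc j p : Set ℕ) := by
    ext k; simp [stair]
  rw [BipGraph.deg, this, Set.ncard_coe_finset, Nat.card_Icc]

lemma stair_adj {p j : ℕ} {a : Fin p} {b : Fin 2}
    (h : (a.val + 1, b.val + 1) ∈ (stair p j).edges) :
    (stair p j).toSimpleGraph.Adj (Sum.inl a) (Sum.inr b) := by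
  rw [BipGraph.toSimpleGraph, SimpleGraph.fromRel_adj]
  exact ⟨by simp, Or.inl ⟨a, b, rfl, rfl, h⟩⟩

lemma stair_connected {p j : ℕ} (hj : 1 ≤ j) (hjp : j ≤ p) :
    (stair p j).toSimpleGraph.Connected := by
  have hc : ∀ b : Fin 2, (stair p j).toSimpleGraph.Reachable (Sum.inr b)
      (Sum.inl (⟨j - 1, by omega⟩ : Fin p)) := by
    intro b
    refine (SimpleGraph.Adj.reachable (stair_adj ?_)).symm
    fin_cases b <;> simp [stair] <;> omega
  have hall : ∀ v, (stair p j).toSimpleGraph.Reachable v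
      (Sum.inl (⟨j - 1, by omega⟩ : Fin p)) := by
    rintro (a | b)
    · rcases Nat.lt_or_ge a.val j with h | h
      · refine (SimpleGraph.Adj.reachable (stair_adj (b := 0) ?_)).trans (hc _)
        simp [stair]; omega
      · refine (SimpleGraph.Adj.reachable (stair_adj (b := 1) ?_)).trans (hc _)
        have := a.2
        simp only [stair] at this
        simp [stair]; omega
    · exact hc b
  exact (SimpleGraph.connected_iff_exists_forall_reachable _).2 ⟨_, fun v => (hall v).symm⟩

/-- Connectedness bounds the number of edges from below, so this upper bound is all that is missing
for a tree. -/
lemma stair_card_edgeSet_le {p j : ℕ} (hj : 1 ≤ j) (hjp : j ≤ p) :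
    Nat.card (stair p j).toSimpleGraph.edgeSet ≤ p + 1 := by
  -- Lists the `j` edges at `r_1`, then those at `r_2`; the shift by one in the second case is due
  -- to `l_j` being listed twice.
  let f : Fin (p + 1) → Sym2 (Fin p ⊕ Fin 2) := fun t =>
    if h : t.val < j then s(Sum.inl ⟨t.val, by omega⟩, Sum.inr 0)
    else s(Sum.inl ⟨t.val - 1, by omega⟩, Sum.inr 1)
  have hf : ∀ (a : Fin p) (b : Fin 2), (a.val + 1, b.val + 1) ∈ (stair p j).edges →
      s(Sum.inl a, Sum.inr b) ∈ Set.range f := by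
    intro a b h
    have hb : b = 0 ∨ b = 1 := by fin_cases b <;> simp
    rcases hb with rfl | rfl
    · have ha : a.val < j := by simp [stair] at h; omega
      exact ⟨⟨a.val, by omega⟩, by simp [f, ha]⟩
    · have ha : ¬ a.val + 1 < j := by simp [stair] at h; omega
      exact ⟨⟨a.val + 1, by omega⟩, by simp [f, ha]⟩
  have hsub : (stair p j).toSimpleGraph.edgeSet ⊆ Set.range f := by
    intro e
    induction e using Sym2.ind with
    | _ u v =>
      rw [SimpleGraph.mem_edgeSet, BipGraph.toSimpleGraph, SimpleGraph.fromRel_adj]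
      rintro ⟨-, ⟨a, b, rfl, rfl, h⟩ | ⟨a, b, rfl, rfl, h⟩⟩
      · exact hf a b h
      · rw [Sym2.eq_swap]; exact hf a b h
  calc Nat.card (stair p j).toSimpleGraph.edgeSet
      ≤ (Set.range f).ncard := Set.ncard_le_ncard hsub (Set.finite_range f)
    _ ≤ Nat.card (Fin (p + 1)) := by
        rw [← Set.image_univ, ← Set.ncard_univ]
        exact Set.ncard_image_le Set.finite_univ
    _ = p + 1 := by simp

lemma stair_isNoncrossingTree {p j : ℕ} (hj : 1 ≤ j) (hjp : j ≤ p) :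
    (stair p j).IsNoncrossingTree := by
  refine ⟨?_, ?_, ?_⟩
  · rintro ⟨a, b⟩ h
    simp only [stair, Set.mem_ofPred_eq] at h ⊢
    omega
  · have hc := stair_connected hj hjp
    refine SimpleGraph.isTree_iff_connected_and_card.2 ⟨hc, ?_⟩
    have h1 := hc.card_vert_le_card_edgeSet_add_one
    have h2 := stair_card_edgeSet_le hj hjp
    have h3 : Nat.card (Fin (stair p j).p ⊕ Fin 2) = p + 2 := by simp [stair]
    omega
  · rintro ⟨a, b⟩ h ⟨a', b'⟩ h' hlt
    simp only [stair, Set.mem_ofPred_eq] at h h' hlt ⊢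
    omega

/-! ### The grove of a maximal clique -/

lemma mem_ext_or_mem_ext {C : Set (List (Edge n))} (hC : IsClique C) {i : ℕ} (hi : i ∈ inner n)
    {x y : Edge n} (hx : IsX i x) (hy : IsY i y) {A : List (Edge n)} (hA : A ∈ prefixes C i) :
    A ∈ ext C x ∨ A ∈ ext C y := by
  have hi' := mem_inner.1 hi
  obtain ⟨hA, B, hAB⟩ := hA
  obtain ⟨g, B', rfl, hg, -⟩ := ((hC.1 _ hAB).right hA).exists_cons (by omega)
  rcases isX_or_isY_of_src hi hg with h | h
  · left
    rw [h.unique hx] at hAB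
    exact ⟨by rwa [hx.src_eq], B', hAB⟩
  · right
    rw [h.unique hy] at hAB
    exact ⟨by rwa [hy.src_eq (by omega)], B', hAB⟩

lemma ext_subset_prefixes {C : Set (List (Edge n))} {i : ℕ} {e : Edge n} (he : src e = i) :
    ext C e ⊆ prefixes C i := by
  rintro A ⟨hA, B, hAB⟩
  exact ⟨he ▸ hA, _, hAB⟩

section Branching

variable {C : Set (List (Edge n))} {i : ℕ} {x y : Edge n} {J : List (Edge n)}

/-- Since `J` is followed by both edges, noncrossing forbids `x` after any prefix above `J` and `y`
after any prefix below it. -/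
lemma ext_slack_eq (hn : 2 ≤ n) (hC : IsClique C) (hi : i ∈ inner n) (hx : IsX i x)
    (hy : IsY i y) (hJx : J ∈ ext C x) (hJy : J ∈ ext C y) :
    ext C x = insert J {A ∈ prefixes C i | PrefixLt A J} := by
  ext A
  constructor
  · intro hA
    have hA' := ext_subset_prefixes hx.src_eq hA
    have hJ' := ext_subset_prefixes hx.src_eq hJx
    rcases prefixLt_trichotomy hn hi hA'.1 hJ'.1 with h | h | h
    · exact Or.inl h
    · exact Or.inr ⟨hA', h⟩
    · exact absurd h (hC.ext_noncrossing hi hx hy hJy hA)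
  · rintro (rfl | ⟨hA, hlt⟩)
    · exact hJx
    · refine (mem_ext_or_mem_ext hC hi hx hy hA).resolve_right fun h => ?_
      exact hC.ext_noncrossing hi hx hy h hJx hlt

lemma ext_nonslack_eq (hn : 2 ≤ n) (hC : IsClique C) (hi : i ∈ inner n) (hx : IsX i x)
    (hy : IsY i y) (hJx : J ∈ ext C x) (hJy : J ∈ ext C y) :
    ext C y = insert J {A ∈ prefixes C i | PrefixLt J A} := by
  have hys := hy.src_eq (by rw [mem_inner] at hi; omega)
  ext A
  constructor
  · intro hA
    have hA' := ext_subset_prefixes hys hA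
    have hJ' := ext_subset_prefixes hx.src_eq hJx
    rcases prefixLt_trichotomy hn hi hA'.1 hJ'.1 with h | h | h
    · exact Or.inl h
    · exact absurd h (hC.ext_noncrossing hi hx hy hA hJx)
    · exact Or.inr ⟨hA', h⟩
  · rintro (rfl | ⟨hA, hlt⟩)
    · exact hJy
    · refine (mem_ext_or_mem_ext hC hi hx hy hA).resolve_left fun h => ?_
      exact hC.ext_noncrossing hi hx hy hJy h hlt

end Branching

/-! ### Positions of prefixes, and degrees in the grove -/

section PrefixPos

variable (hn : 2 ≤ n) {C : Set (List (Edge n))} {i : ℕ}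
include hn

lemma prefixPos_lt {P Q : List (Edge n)} (hP : P ∈ prefixes C i) (h : PrefixLt P Q) :
    prefixPos C i P < prefixPos C i Q := by
  refine Nat.add_lt_add_right (Set.ncard_lt_ncard ?_
    ((finite_prefixes hn C i).subset (Set.sep_subset _ _))) 1
  exact ⟨fun A hA => ⟨hA.1, hA.2.trans h⟩, fun hsub => PrefixLt.irrefl _ (hsub ⟨hP, h⟩).2⟩

lemma prefixPos_le {P : List (Edge n)} (hP : P ∈ prefixes C i) :
    prefixPos C i P ≤ (prefixes C i).ncard := by
  refine Nat.succ_le_of_lt (Set.ncard_lt_ncard ⟨Set.sep_subset _ _, fun hsub => ?_⟩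
    (finite_prefixes hn C i))
  exact PrefixLt.irrefl _ (hsub hP).2

lemma prefixPos_injOn (hi : i ∈ inner n) : Set.InjOn (prefixPos C i) (prefixes C i) := by
  intro P hP Q hQ h
  rcases prefixLt_trichotomy hn hi hP.1 hQ.1 with h' | h' | h'
  · exact h'
  · exact absurd h (prefixPos_lt hn hP h').ne
  · exact absurd h (prefixPos_lt hn hQ h').ne'

/-- An injection from a set of size p into {1, …, p} is onto. -/
lemma exists_prefixPos_eq (hi : i ∈ inner n) {k : ℕ} (hk : 1 ≤ k)
    (hk' : k ≤ (prefixes C i).ncard) : ∃ P ∈ prefixes C i, prefixPos C i P = k := by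
  have hsub : prefixPos C i '' prefixes C i ⊆ (Finset.Icc 1 (prefixes C i).ncard : Set ℕ) := by
    rintro _ ⟨P, hP, rfl⟩
    rw [Finset.coe_Icc]
    exact ⟨Nat.le_add_left _ _, prefixPos_le hn hP⟩
  have heq := Set.eq_of_subset_of_ncard_le hsub (by
    rw [(prefixPos_injOn hn hi).ncard_image, Set.ncard_coe_finset, Nat.card_Icc]
    omega) (Finset.finite_toSet _)
  have hmem : k ∈ prefixPos C i '' prefixes C i := by
    rw [heq, Finset.coe_Icc]
    exact ⟨hk, hk'⟩
  exact hmem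

lemma IsMaximalClique.ncard_ext_slack (hi : i ∈ inner n) (hC : IsMaximalClique C) {x y : Edge n}
    (hx : IsX i x) (hy : IsY i y) {J : List (Edge n)} (hJx : J ∈ ext C x) (hJy : J ∈ ext C y) :
    (ext C x).ncard = prefixPos C i J := by
  have hJ : J ∉ {A ∈ prefixes C i | PrefixLt A J} := fun h => PrefixLt.irrefl _ h.2
  rw [ext_slack_eq hn hC.1 hi hx hy hJx hJy, Set.ncard_insert_of_notMem hJ
    ((finite_prefixes hn C i).subset (Set.sep_subset _ _))]
  rfl

/-- The position of the branching prefix equals the number of prefixes followed by the slack edge,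
so the tree depends on two numbers only. -/
lemma IsMaximalClique.groveOf_eq_stair (hi : i ∈ inner n) (hC : IsMaximalClique C) {x : Edge n}
    (hx : IsX i x) : groveOf C i = stair (prefixes C i).ncard (ext C x).ncard := by
  have hi' := mem_inner.1 hi
  obtain ⟨y, hy⟩ := exists_isY (n := n) (i := i) (by omega)
  have hys := hy.src_eq (by omega)
  obtain ⟨J, hJx, hJy⟩ := hC.exists_branching hn hi hx hy
  have hJ := ext_subset_prefixes hx.src_eq hJx
  have hxeq := ext_slack_eq hn hC.1 hi hx hy hJx hJy
  have hyeq := ext_nonslack_eq hn hC.1 hi hx hy hJx hJy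
  have hox : outPos x = 1 := by
    have := hx.isLeft
    rcases x with k | k <;> simp [outPos] at this ⊢
  have hoy : outPos y = 2 := by
    have := hy.isRight
    rcases y with k | k <;> simp [outPos] at this ⊢
  rw [hC.ncard_ext_slack hn hi hx hy hJx hJy]
  ext1
  · rfl
  · ext ⟨a, b⟩
    simp only [groveOf, stair, Set.mem_ofPred_eq, Prod.mk.injEq]
    constructor
    · rintro ⟨P, Q, e, hP, he, hmem, rfl, rfl⟩
      have hP' : P ∈ ext C e := ⟨he ▸ hP, Q, hmem⟩
      have hpos : 1 ≤ prefixPos C i P := Nat.le_add_left _ _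
      rcases isX_or_isY_of_src hi he with h | h
      · left
        rw [h.unique hx] at hP' ⊢
        refine ⟨hox, hpos, ?_⟩
        rw [hxeq] at hP'
        rcases hP' with rfl | hP'
        · exact le_rfl
        · exact (prefixPos_lt hn hP'.1 hP'.2).le
      · right
        rw [h.unique hy] at hP' ⊢
        refine ⟨hoy, ?_, prefixPos_le hn (ext_subset_prefixes hys hP')⟩
        rw [hyeq] at hP'
        rcases hP' with rfl | hP'
        · exact le_rfl
        · exact (prefixPos_lt hn hJ hP'.2).le
    · rintro (⟨rfl, h1, h2⟩ | ⟨rfl, h1, h2⟩)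
      · obtain ⟨P, hP, rfl⟩ := exists_prefixPos_eq hn hi h1 (h2.trans (prefixPos_le hn hJ))
        have hPx : P ∈ ext C x := by
          rw [hxeq]
          rcases prefixLt_trichotomy hn hi hP.1 hJ.1 with h | h | h
          · exact Or.inl h
          · exact Or.inr ⟨hP, h⟩
          · exact absurd (prefixPos_lt hn hJ h) (not_lt.2 h2)
        obtain ⟨-, Q, hQ⟩ := hPx
        exact ⟨P, Q, x, hP.1, hx.src_eq, hQ, rfl, hox.symm⟩
      · have hpos : 1 ≤ prefixPos C i J := Nat.le_add_left _ _
        obtain ⟨P, hP, rfl⟩ := exists_prefixPos_eq hn hi (hpos.trans h1) h2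
        have hPy : P ∈ ext C y := by
          rw [hyeq]
          rcases prefixLt_trichotomy hn hi hP.1 hJ.1 with h | h | h
          · exact Or.inl h
          · exact absurd (prefixPos_lt hn hP h) (not_lt.2 h1)
          · exact Or.inr ⟨hP, h⟩
        obtain ⟨-, Q, hQ⟩ := hPy
        exact ⟨P, Q, y, hP.1, hys, hQ, rfl, hoy.symm⟩

/-- The two sets cover the prefixes at `i` and share only the branching prefix. -/
lemma IsMaximalClique.ncard_ext_add (hi : i ∈ inner n) (hC : IsMaximalClique C) {x y : Edge n}
    (hx : IsX i x) (hy : IsY i y) :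
    (ext C x).ncard + (ext C y).ncard = (prefixes C i).ncard + 1 := by
  have hys := hy.src_eq (by rw [mem_inner] at hi; omega)
  obtain ⟨J, hJx, hJy⟩ := hC.exists_branching hn hi hx hy
  have hunion : ext C x ∪ ext C y = prefixes C i := by
    refine Set.Subset.antisymm (Set.union_subset (ext_subset_prefixes hx.src_eq)
      (ext_subset_prefixes hys)) fun A hA => mem_ext_or_mem_ext hC.1 hi hx hy hA
  have hinter : ext C x ∩ ext C y = {J} := by
    refine Set.Subset.antisymm (fun A hA => ?_) (by rintro A rfl; exact ⟨hJx, hJy⟩)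
    have h1 := hA.1
    have h2 := hA.2
    rw [ext_slack_eq hn hC.1 hi hx hy hJx hJy] at h1
    rw [ext_nonslack_eq hn hC.1 hi hx hy hJx hJy] at h2
    rcases h1 with h1 | h1
    · exact h1
    · rcases h2 with h2 | h2
      · exact h2
      · exact absurd h1.2 h2.2.asymm
  rw [← Set.ncard_union_add_ncard_inter _ _ (finite_ext hn C x) (finite_ext hn C y), hunion,
    hinter, Set.ncard_singleton]

/-- Prefixes are sorted by their last edge. With `ncard_ext_add` this gives flow conservation and
the recursion for the nonslack degrees. -/
lemma ncard_prefixes (hi : i ∈ inner n) {x y : Edge n}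
    (hx : IsX (i - 1) x) (hy : IsY (i - 2) y) :
    (prefixes C i).ncard = (ext C x).ncard + (ext C y).ncard := by
  have hi' := mem_inner.1 hi
  have hxt : tgt x = i := by rw [hx.tgt_eq]; omega
  have hyt : tgt y = i := by rw [hy.tgt_eq (by omega)]; omega
  have hunion : prefixes C i = (fun A => A ++ [x]) '' ext C x ∪ (fun A => A ++ [y]) '' ext C y := by
    ext A
    constructor
    · rintro ⟨hA, Q, hQ⟩
      obtain ⟨A', g, rfl, hA', hg⟩ := hA.exists_concat (by omega)
      rw [List.append_assoc] at hQ
      rcases isX_or_isY_of_tgt hi hg with h | h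
      · obtain rfl := h.unique hx
        exact Or.inl ⟨A', ⟨hA', Q, hQ⟩, rfl⟩
      · obtain rfl := h.unique hy
        exact Or.inr ⟨A', ⟨hA', Q, hQ⟩, rfl⟩
    · rintro (⟨A, ⟨hA, Q, hQ⟩, rfl⟩ | ⟨A, ⟨hA, Q, hQ⟩, rfl⟩)
      · exact ⟨isPath_concat.2 ⟨hA, hxt⟩, Q, by simpa using hQ⟩
      · exact ⟨isPath_concat.2 ⟨hA, hyt⟩, Q, by simpa using hQ⟩
  rw [hunion, Set.ncard_union_eq ?_ ((finite_ext hn C x).image _) ((finite_ext hn C y).image _),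
    Set.ncard_image_of_injective _ (List.append_left_injective _),
    Set.ncard_image_of_injective _ (List.append_left_injective _)]
  rw [Set.disjoint_left]
  rintro _ ⟨A, -, rfl⟩ ⟨B, -, h⟩
  have h3 := hx.isLeft
  have h4 := hy.isRight
  have h5 : y = x := by simpa using congrArg List.getLast? h
  rw [h5] at h4
  rcases x with k | k <;> simp at h3 h4

/-- Only the empty prefix ends at `1`; this matches the default values `1` in `edgeDeg` and `0` in
`flowOf`. -/
lemma IsMaximalClique.ncard_ext_source (hC : IsMaximalClique C) {e : Edge n} (he : src e = 1) :
    (ext C e).ncard = 1 := by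
  obtain ⟨A, hA⟩ := hC.ext_nonempty hn e
  have : ext C e = {A} := by
    refine Set.Subset.antisymm (fun B hB => ?_) (by rintro B rfl; exact hA)
    have h1 := hA.1
    have h2 := hB.1
    rw [he] at h1 h2
    rw [h1.eq_nil hn, h2.eq_nil hn]
    rfl
  rw [this, Set.ncard_singleton]

lemma IsMaximalClique.ncard_ext_pos (hC : IsMaximalClique C) (e : Edge n) :
    1 ≤ (ext C e).ncard :=
  (Set.ncard_pos (finite_ext hn C e)).2 (hC.ext_nonempty hn e)

lemma IsMaximalClique.groveOf_deg (hC : IsMaximalClique C) {e : Edge n} (he : src e ≠ 1) :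
    (groveOf C (src e)).deg (outPos e) = (ext C e).ncard := by
  have h1 := one_le_src e
  have h2 := src_lt_tgt hn e
  have h3 := tgt_le hn e
  have hi : src e ∈ inner n := mem_inner.2 (by omega)
  obtain ⟨x, hx⟩ := exists_isX (n := n) (i := src e) (by omega) (by omega)
  obtain ⟨y, hy⟩ := exists_isY (n := n) (i := src e) (by omega)
  have hadd := hC.ncard_ext_add hn hi hx hy
  rw [hC.groveOf_eq_stair hn hi hx]
  rcases isX_or_isY_of_src hi rfl with h | h
  · have ho : outPos e = 1 := by
      have := h.isLeft
      rcases e with k | k <;> simp [outPos] at this ⊢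
    rw [ho, stair_deg_one, h.unique hx]
  · have ho : outPos e = 2 := by
      have := h.isRight
      rcases e with k | k <;> simp [outPos] at this ⊢
    rw [ho, stair_deg_two, ← hadd, ← h.unique hy]
    omega

lemma IsMaximalClique.edgeDeg_groveOf (hC : IsMaximalClique C) (e : Edge n) :
    edgeDeg (groveOf C) e = (ext C e).ncard := by
  unfold edgeDeg
  split_ifs with h
  · rw [hC.ncard_ext_source hn h]
  · exact hC.groveOf_deg hn h

lemma IsMaximalClique.flowOf_groveOf (hC : IsMaximalClique C) (e : Edge n) :
    flowOf (groveOf C) e = ((ext C e).ncard : ℤ) - 1 := by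
  unfold flowOf
  split_ifs with h
  · rw [hC.ncard_ext_source hn h]; simp
  · rw [hC.groveOf_deg hn h]

end PrefixPos

/-! ### The grove condition and flow conservation -/

lemma filter_tgt_eq {i : ℕ} (hi : i ∈ inner n) {x y : Edge n} (hx : IsX (i - 1) x)
    (hy : IsY (i - 2) y) : Finset.univ.filter (fun e : Edge n => tgt e = i) = {x, y} := by
  have hi' := mem_inner.1 hi
  ext e
  simp only [Finset.mem_filter, Finset.mem_univ, true_and, Finset.mem_insert,
    Finset.mem_singleton]
  constructor
  · intro h
    rcases isX_or_isY_of_tgt hi h with h | h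
    · exact Or.inl (h.unique hx)
    · exact Or.inr (h.unique hy)
  · rintro (rfl | rfl)
    · rw [hx.tgt_eq]; omega
    · rw [hy.tgt_eq (by omega)]; omega

lemma filter_src_eq {i : ℕ} (hi : i ∈ inner n) {x y : Edge n} (hx : IsX i x)
    (hy : IsY i y) : Finset.univ.filter (fun e : Edge n => src e = i) = {x, y} := by
  have hi' := mem_inner.1 hi
  ext e
  simp only [Finset.mem_filter, Finset.mem_univ, true_and, Finset.mem_insert,
    Finset.mem_singleton]
  constructor
  · intro h
    rcases isX_or_isY_of_src hi h with h | h
    · exact Or.inl (h.unique hx)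
    · exact Or.inr (h.unique hy)
  · rintro (rfl | rfl)
    · exact hx.src_eq
    · exact hy.src_eq (by omega)

lemma IsX.ne_isY {i k : ℕ} {x y : Edge n} (hx : IsX i x) (hy : IsY k y) : x ≠ y := by
  rintro rfl
  have h3 := hx.isLeft
  have h4 := hy.isRight
  rcases x with k | k <;> simp at h3 h4

lemma IsMaximalClique.isGrove (hn : 2 ≤ n) {C : Set (List (Edge n))} (hC : IsMaximalClique C) :
    IsGrove n (groveOf C) := by
  intro i hi
  have hi' := mem_inner.1 hi
  obtain ⟨x, hx⟩ := exists_isX (n := n) (i := i) (by omega) (by omega)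
  obtain ⟨y, hy⟩ := exists_isY (n := n) (i := i) (by omega)
  obtain ⟨x', hx'⟩ := exists_isX (n := n) (i := i - 1) (by omega) (by omega)
  obtain ⟨y', hy'⟩ := exists_isY (n := n) (i := i - 2) (by omega)
  constructor
  · rw [hC.groveOf_eq_stair hn hi hx]
    have h1 := hC.ncard_ext_add hn hi hx hy
    have h2 := hC.ncard_ext_pos hn y
    exact stair_isNoncrossingTree (hC.ncard_ext_pos hn x) (by omega)
  · rw [filter_tgt_eq hi hx' hy', Finset.sum_pair (hx'.ne_isY hy'), hC.edgeDeg_groveOf hn,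
      hC.edgeDeg_groveOf hn, ← ncard_prefixes (C := C) hn hi hx' hy']
    rfl

lemma IsMaximalClique.conservation (hn : 2 ≤ n) {C : Set (List (Edge n))}
    (hC : IsMaximalClique C) {i : ℕ} (hi : i ∈ inner n) :
    (∑ e ∈ Finset.univ.filter (fun e : Edge n => tgt e = i), flowOf (groveOf C) e) +
      ((indeg n i : ℤ) - 1) =
    ∑ e ∈ Finset.univ.filter (fun e : Edge n => src e = i), flowOf (groveOf C) e := by
  have hi' := mem_inner.1 hi
  obtain ⟨x, hx⟩ := exists_isX (n := n) (i := i) (by omega) (by omega)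
  obtain ⟨y, hy⟩ := exists_isY (n := n) (i := i) (by omega)
  obtain ⟨x', hx'⟩ := exists_isX (n := n) (i := i - 1) (by omega) (by omega)
  obtain ⟨y', hy'⟩ := exists_isY (n := n) (i := i - 2) (by omega)
  rw [indeg, filter_tgt_eq hi hx' hy', filter_src_eq hi hx hy, Finset.sum_pair (hx'.ne_isY hy'),
    Finset.sum_pair (hx.ne_isY hy), Finset.card_pair (hx'.ne_isY hy')]
  simp only [hC.flowOf_groveOf hn]
  have h1 := hC.ncard_ext_add hn hi hx hy
  have h2 := ncard_prefixes (C := C) hn hi hx' hy'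
  push_cast
  omega

lemma IsMaximalClique.isIntegerFlow (hn : 2 ≤ n) {C : Set (List (Edge n))}
    (hC : IsMaximalClique C) : IsIntegerFlow (flowOf (n := n) (groveOf C)) := by
  have hin1 : Finset.univ.filter (fun e : Edge n => tgt e = 1) = ∅ := by
    refine Finset.filter_eq_empty_iff.2 fun e _ h => ?_
    have h1 := one_le_src e
    have h2 := src_lt_tgt hn e
    omega
  have houtn : Finset.univ.filter (fun e : Edge n => src e = n) = ∅ := by
    refine Finset.filter_eq_empty_iff.2 fun e _ h => ?_
    have h1 := tgt_le hn e
    have h2 := src_lt_tgt hn e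
    omega
  have hout1 : ∑ e ∈ Finset.univ.filter (fun e : Edge n => src e = 1), flowOf (groveOf C) e = 0 := by
    refine Finset.sum_eq_zero fun e he => ?_
    rw [flowOf, if_pos (Finset.mem_filter.1 he).2]
  refine ⟨fun e => ?_, fun i hi => ?_⟩
  · rw [hC.flowOf_groveOf hn]
    have := hC.ncard_ext_pos hn e
    omega
  rw [Finset.mem_Icc] at hi
  unfold shiftedIndeg
  split_ifs with h1 h2
  · rw [h1, hin1, hout1]; simp
  -- The balance at the sink follows from the others: inflow and outflow summed over all vertices
  -- both give the total flow, and vertex `1` contributes zero to each.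
  · subst h2
    have hsplit : Finset.Icc 1 i = insert 1 (insert i (inner i)) := by
      ext k; simp only [Finset.mem_Icc, Finset.mem_insert, mem_inner]; omega
    have hn1 : 1 ∉ insert i (inner i) := by
      simp only [Finset.mem_insert, mem_inner]; omega
    have hni : i ∉ inner i := by
      simp only [mem_inner]; omega
    have ht := Finset.sum_fiberwise_of_maps_to (s := Finset.univ) (t := Finset.Icc 1 i)
      (g := fun e : Edge i => tgt e) (fun e _ => Finset.mem_Icc.2
        ⟨(one_le_src e).trans (src_lt_tgt hn e).le, tgt_le hn e⟩) (flowOf (groveOf C))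
    have hs := Finset.sum_fiberwise_of_maps_to (s := Finset.univ) (t := Finset.Icc 1 i)
      (g := fun e : Edge i => src e) (fun e _ => Finset.mem_Icc.2
        ⟨one_le_src e, (src_lt_tgt hn e).le.trans (tgt_le hn e)⟩) (flowOf (groveOf C))
    rw [hsplit, Finset.sum_insert hn1, Finset.sum_insert hni] at ht hs
    rw [hin1] at ht
    rw [houtn, hout1] at hs
    have hsum := Finset.sum_congr rfl fun k hk => hC.conservation hn (i := k) hk
    rw [Finset.sum_add_distrib] at hsum
    rw [houtn]
    simp only [Finset.sum_empty] at ht hs ⊢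
    linarith
  · exact hC.conservation hn (mem_inner.2 (by omega))

/-! ### Adjacent simplices -/

/-- Sources increase along a path, so its first edge is its only edge leaving the first vertex. -/
lemma IsPath.eq_of_mem_iff (hn : 2 ≤ n) {a b : ℕ} {P Q : List (Edge n)} (hP : IsPath a P b)
    (hQ : IsPath a Q b) (h : ∀ e, e ∈ P ↔ e ∈ Q) : P = Q := by
  induction P generalizing a Q with
  | nil =>
    symm
    exact List.eq_nil_iff_forall_not_mem.2 fun e he => by simpa using (h e).2 he
  | cons e P ih =>
    cases Q with
    | nil => simpa using (h e).1
    | cons f Q =>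
      have hlate : ∀ {c : ℕ} {M : List (Edge n)} {g : Edge n}, IsPath c M b → g ∈ M → a < c →
          src g ≠ a := fun hM hg hc => by
        have := hM.src_mem hn hg
        omega
      have hea : a < tgt e := hP.1 ▸ src_lt_tgt hn e
      have hfa : a < tgt f := hQ.1 ▸ src_lt_tgt hn f
      have hef : e = f := by
        rcases List.mem_cons.1 ((h e).1 (by simp)) with h' | h'
        · exact h'
        · exact absurd hP.1 (hlate hQ.2 h' hfa)
      subst hef
      rw [ih hP.2 hQ.2 fun g => ?_]
      have hg := h g
      simp only [List.mem_cons] at hg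
      constructor
      · intro hgP
        refine (hg.1 (Or.inr hgP)).resolve_left ?_
        rintro rfl
        exact hlate hP.2 hgP hea hP.1
      · intro hgQ
        refine (hg.2 (Or.inr hgQ)).resolve_left ?_
        rintro rfl
        exact hlate hQ.2 hgQ hea hP.1

lemma routeVec_injOn (hn : 2 ≤ n) : Set.InjOn (routeVec (n := n)) {R | IsRoute R} := by
  intro R hR R' hR' h
  refine IsPath.eq_of_mem_iff hn hR hR' fun e => ?_
  have he := congrFun h e
  by_cases h1 : e ∈ R <;> by_cases h2 : e ∈ R' <;>
    simp [routeVec, Set.indicator, h1, h2] at he ⊢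

/-- A set of points with coordinates `0` and `1` is in convex position. -/
lemma extremePoints_convexHull_of_zero_one {ι : Type*} {V : Set (ι → ℝ)}
    (hV : ∀ v ∈ V, ∀ k, v k = 0 ∨ v k = 1) : (convexHull ℝ V).extremePoints ℝ = V := by
  refine Set.Subset.antisymm extremePoints_convexHull_subset fun v hv => ?_
  have hsub : convexHull ℝ V ⊆ Set.univ.pi fun _ : ι => Set.Icc (0 : ℝ) 1 := by
    refine convexHull_min (fun w hw k _ => ?_) (convex_pi fun _ _ => convex_Icc 0 1)
    rcases hV w hw k with h | h <;> simp [h]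
  -- A vertex of the unit cube is extreme in the cube, hence in every subset of the cube that
  -- contains it.
  refine inter_extremePoints_subset_extremePoints_of_subset hsub ⟨subset_convexHull ℝ V hv, ?_⟩
  rw [extremePoints_pi]
  intro k _
  rw [Set.extremePoints_Icc zero_le_one]
  simpa using hV v hv k

lemma extremePoints_simplex (C : Set (List (Edge n))) :
    (simplex C).extremePoints ℝ = routeVec '' C := by
  refine extremePoints_convexHull_of_zero_one ?_
  rintro _ ⟨R, -, rfl⟩ e
  by_cases h : e ∈ R <;> simp [routeVec, Set.indicator, h]

lemma IsFacet.exists_route (hn : 2 ≤ n) {C : Set (List (Edge n))} (hC : IsClique C)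
    {F : Set (Edge n → ℝ)} (hF : IsFacet F (simplex C)) :
    ∃ R ∈ C, F = simplex (C \ {R}) := by
  obtain ⟨v, hv, rfl⟩ := hF
  rw [extremePoints_simplex] at hv ⊢
  obtain ⟨R, hR, rfl⟩ := hv
  refine ⟨R, hR, ?_⟩
  rw [simplex, ← Set.image_singleton, ((routeVec_injOn hn).mono hC.1).image_sdiff_subset
    (Set.singleton_subset_iff.2 hR)]

/-- Cliques with adjacent simplices differ by the exchange of one route. -/
lemma Adjacent.exists_exchange (hn : 2 ≤ n) {C C' : Set (List (Edge n))} (hC : IsClique C)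
    (hC' : IsClique C') (h : Adjacent (simplex C) (simplex C')) :
    C ≠ C' ∧ ∃ R ∈ C, ∃ R' ∈ C', C \ {R} = C' \ {R'} := by
  obtain ⟨hne, F, hF, hF'⟩ := h
  refine ⟨fun h => hne (h ▸ rfl), ?_⟩
  obtain ⟨R, hR, rfl⟩ := hF.exists_route hn hC
  obtain ⟨R', hR', heq⟩ := hF'.exists_route hn hC'
  refine ⟨R, hR, R', hR', ?_⟩
  -- Equal facets have equal extreme points, and these recover the sets of routes.
  have := congrArg (fun Δ => Δ.extremePoints ℝ) heq
  simp only [extremePoints_simplex] at this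
  exact ((routeVec_injOn hn).image_eq_image_iff (fun S hS => hC.1 S hS.1)
    fun S hS => hC'.1 S hS.1).1 this

/-! ### Exchanging one route of a maximal clique -/

-- If no other route of `C` begins like `R` up to and including `e`, then removing `R` loses exactly
-- its own prefix in front of `e`.
open Classical in
lemma ncard_ext_eq_add (hn : 2 ≤ n) {C : Set (List (Edge n))} {R : List (Edge n)}
    (hC : IsClique C) (hR : R ∈ C) {e : Edge n}
    (h : ∀ A B Q, R = A ++ e :: B → A ++ e :: Q ∈ C → A ++ e :: Q = R) :
    (ext C e).ncard = (ext (C \ {R}) e).ncard + if e ∈ R then 1 else 0 := by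
  have hsub : ext (C \ {R}) e ⊆ ext C e := fun A ⟨hA, Q, hQ⟩ => ⟨hA, Q, hQ.1⟩
  split_ifs with he
  · obtain ⟨A, B, hAB, hA, -⟩ := (hC.1 R hR).exists_split he
    have hins : ext C e = insert A (ext (C \ {R}) e) := by
      refine Set.Subset.antisymm (fun X hX => ?_) (Set.insert_subset ⟨hA, B, hAB ▸ hR⟩ hsub)
      obtain ⟨hX, Q, hQ⟩ := hX
      by_cases hXR : X ++ e :: Q = R
      · exact Or.inl (hX.append_inj hn hA (hXR.trans hAB)).1
      · exact Or.inr ⟨hX, Q, hQ, hXR⟩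
    have hnot : A ∉ ext (C \ {R}) e := fun ⟨_, Q, hQ⟩ => hQ.2 (h A B Q hAB hQ.1)
    rw [hins, Set.ncard_insert_of_notMem hnot (finite_ext hn _ e)]
  · have : ext C e = ext (C \ {R}) e := by
      refine Set.Subset.antisymm (fun X ⟨hX, Q, hQ⟩ => ⟨hX, Q, hQ, ?_⟩) hsub
      rintro rfl
      simp at he
    rw [this, add_zero]

/-- If two routes are exchanged whose initial parts `U` and `U'` occur in no other route and have
the same position among the remaining prefixes, then the routes agree from there on. -/
lemma tail_eq_of_exchange (hn : 2 ≤ n) {C C' : Set (List (Edge n))} (hC : IsMaximalClique C)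
    (hC' : IsMaximalClique C') {R R' : List (Edge n)} (hD : C \ {R} = C' \ {R'})
    (hRC : R ∈ C) (hRC' : R' ∈ C') {k : ℕ} (hk : 2 ≤ k) {U U' Z Z' : List (Edge n)}
    (hR : R = U ++ Z) (hR' : R' = U' ++ Z') (hUk : IsPath 1 U k) (hUk' : IsPath 1 U' k)
    (hU : ∀ Q, U ++ Q ∈ C → Q = Z) (hU' : ∀ Q, U' ++ Q ∈ C' → Q = Z')
    (hpos : ∀ A ∈ prefixes (C \ {R}) k, (PrefixLt A U ↔ PrefixLt A U')) : Z = Z' := by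
  have hZ : IsPath k Z n := (hC.1.1 _ (hR ▸ hRC)).right hUk
  have hZ' : IsPath k Z' n := (hC'.1.1 _ (hR' ▸ hRC')).right hUk'
  induction Z generalizing k U U' Z' with
  | nil =>
    obtain rfl : k = n := hZ
    exact (hZ'.eq_nil hn).symm
  | cons g Z ih =>
    have hg : src g = k := hZ.1
    have h2 := src_lt_tgt hn g
    have h3 := tgt_le hn g
    obtain ⟨g', Z', rfl, hg', hZt'⟩ := hZ'.exists_cons (by omega)
    have hki : k ∈ inner n := mem_inner.2 (by omega)
    obtain ⟨x, hx⟩ := exists_isX (n := n) (i := k) (by omega) (by omega)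
    obtain ⟨y, hy⟩ := exists_isY (n := n) (i := k) (by omega)
    have hxs := hx.src_eq
    have hys := hy.src_eq (by omega)
    obtain ⟨J, hJx, hJy⟩ := hC.exists_branching hn hki hx hy
    -- `U` has a single continuation in `C`, so it cannot branch.
    have hJU : J ≠ U := by
      rintro rfl
      obtain ⟨-, Q, hQ⟩ := hJx
      obtain ⟨-, Q', hQ'⟩ := hJy
      have h4 := (hU _ hQ).trans (hU _ hQ').symm
      exact hx.ne_isY hy (List.cons.inj h4).1
    have hJk : IsPath 1 J k := hxs ▸ hJx.1
    -- Therefore the routes through `J` survive the exchange and `J` branches in `C'` too. The side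
    -- of `J` on which `U` and `U'` lie then decides both next edges.
    have hmemD : ∀ Q, J ++ Q ∈ C → J ++ Q ∈ C \ {R} := fun Q hQ =>
      ⟨hQ, fun h => hJU (hJk.append_inj hn hUk (h.trans hR)).1⟩
    have hmem : ∀ Q, J ++ Q ∈ C → J ++ Q ∈ C' := fun Q hQ =>
      (hD ▸ hmemD Q hQ : J ++ Q ∈ C' \ {R'}).1
    have hJx' : J ∈ ext C' x := ⟨hJx.1, hJx.2.imp fun Q hQ => hmem _ hQ⟩
    have hJy' : J ∈ ext C' y := ⟨hJy.1, hJy.2.imp fun Q hQ => hmem _ hQ⟩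
    have hJU' : J ≠ U' := by
      rintro rfl
      obtain ⟨-, Q, hQ⟩ := hJx'
      obtain ⟨-, Q', hQ'⟩ := hJy'
      have h4 := (hU' _ hQ).trans (hU' _ hQ').symm
      exact hx.ne_isY hy (List.cons.inj h4).1
    have hJD : J ∈ prefixes (C \ {R}) k := ⟨hJk, hJx.2.elim fun Q hQ => ⟨_, hmemD _ hQ⟩⟩
    have hUg : U ∈ ext C g := ⟨hg ▸ hUk, Z, hR ▸ hRC⟩
    have hUg' : U' ∈ ext C' g' := ⟨hg' ▸ hUk', Z', hR' ▸ hRC'⟩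
    have hgg : g = g' := by
      rcases prefixLt_trichotomy hn hki hJk hUk with h | h | h
      · exact absurd h hJU
      · have h' := (hpos J hJD).1 h
        have e1 : IsY k g := (isX_or_isY_of_src hki hg).resolve_left fun hgx =>
          hC.1.ext_noncrossing hki hgx hy hJy hUg h
        have e2 : IsY k g' := (isX_or_isY_of_src hki hg').resolve_left fun hgx =>
          hC'.1.ext_noncrossing hki hgx hy hJy' hUg' h'
        exact e1.unique e2
      · have h' : PrefixLt U' J := by
          rcases prefixLt_trichotomy hn hki hJk hUk' with h4 | h4 | h4
          · exact absurd h4 hJU'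
          · exact absurd ((hpos J hJD).2 h4) h.asymm
          · exact h4
        have e1 : IsX k g := (isX_or_isY_of_src hki hg).resolve_right fun hgy =>
          hC.1.ext_noncrossing hki hx hgy hUg hJx h
        have e2 : IsX k g' := (isX_or_isY_of_src hki hg').resolve_right fun hgy =>
          hC'.1.ext_noncrossing hki hx hgy hUg' hJx' h'
        exact e1.unique e2
    subst hgg
    congr 1
    refine ih (k := tgt g) (U := U ++ [g]) (U' := U' ++ [g]) (by omega) (by simp [hR])
      (by simp [hR']) (isPath_concat.2 ⟨hg ▸ hUk, rfl⟩) (isPath_concat.2 ⟨hg ▸ hUk', rfl⟩)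
      (fun Q hQ => ?_) (fun Q hQ => ?_) (fun A hA => ?_) hZ.2 hZt'
    · exact (List.cons.inj (hU (g :: Q) (by simpa using hQ))).2
    · exact (List.cons.inj (hU' (g :: Q) (by simpa using hQ))).2
    -- Equal position persists after the common edge `g`: prefixes are compared by their last edges,
    -- and if these agree, by `hpos`.
    · obtain ⟨hA, Q, hQ⟩ := hA
      obtain ⟨A, h, rfl, hA', hh⟩ := hA.exists_concat (by omega)
      rw [prefixLt_concat, prefixLt_concat]
      refine or_congr_right (and_congr_right ?_)
      rintro rfl
      exact hpos A ⟨hg ▸ hA', h :: Q, by simpa using hQ⟩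

section Exchange

variable {C C' : Set (List (Edge n))} {R R' P P' Z Z' : List (Edge n)} {i : ℕ} {x y : Edge n}

lemma mem_of_sdiff_eq (hD : C \ {R} = C' \ {R'}) {T : List (Edge n)} (hT : T ∈ C) (hne : T ≠ R) :
    T ∈ C' :=
  (hD ▸ (⟨hT, hne⟩ : T ∈ C \ {R}) : T ∈ C' \ {R'}).1

lemma cons_append_ne (hn : 2 ≤ n) {A B Q Q' : List (Edge n)} {e f : Edge n} (hA : IsPath 1 A i)
    (hB : IsPath 1 B i) (hef : e ≠ f) : A ++ e :: Q ≠ B ++ f :: Q' := fun h =>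
  hef (List.cons.inj (hA.append_inj hn hB h).2).1

/-- At the vertex where the exchanged routes diverge, their prefixes are the branching prefixes, and
followed by the edges of these routes they occur in no other route. -/
lemma exchange_branching (hn : 2 ≤ n) (hC : IsMaximalClique C) (hC' : IsMaximalClique C')
    (hD : C \ {R} = C' \ {R'}) (hRC : R ∈ C) (hRC' : R' ∈ C')
    (hi : i ∈ inner n) (hx : IsX i x) (hy : IsY i y) (hR : R = P ++ x :: Z)
    (hR' : R' = P' ++ y :: Z') (hP : IsPath 1 P i) (hP' : IsPath 1 P' i) (hlt : PrefixLt P' P) :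
    (∀ Q, P ++ x :: Q ∈ C → Q = Z) ∧ (∀ Q, P' ++ y :: Q ∈ C' → Q = Z') ∧
    P ∈ ext C y ∧ P' ∈ ext C' x := by
  have hi' := mem_inner.1 hi
  have hxs := hx.src_eq
  have hys := hy.src_eq (by omega)
  have hxy := hx.ne_isY hy
  obtain ⟨J, hJx, hJy⟩ := hC.exists_branching hn hi hx hy
  obtain ⟨J', hJx', hJy'⟩ := hC'.exists_branching hn hi hx hy
  have hJi : IsPath 1 J i := hxs ▸ hJx.1
  have hJi' : IsPath 1 J' i := hxs ▸ hJx'.1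
  have hPJ : ¬ PrefixLt J P := hC.1.ext_noncrossing hi hx hy hJy ⟨hxs ▸ hP, Z, hR ▸ hRC⟩
  have hPJ' : ¬ PrefixLt P' J' :=
    hC'.1.ext_noncrossing hi hx hy ⟨hys ▸ hP', Z', hR' ▸ hRC'⟩ hJx'
  -- The chain is J' ≼ P' ≺ P ≼ J.
  have hJJ : PrefixLt J' J := by
    have h1 : PrefixLt J' P := by
      rcases prefixLt_trichotomy hn hi hJi' hP' with rfl | h | h
      · exact hlt
      · exact h.trans hlt
      · exact absurd h hPJ'
    rcases prefixLt_trichotomy hn hi hJi hP with rfl | h | h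
    · exact h1
    · exact absurd h hPJ
    · exact h1.trans h
  have hJyC' : J ∈ ext C' y := ⟨hJy.1, hJy.2.imp fun Q hQ =>
    mem_of_sdiff_eq hD hQ (hR ▸ cons_append_ne hn hJi hP hxy.symm)⟩
  have hJxC : J' ∈ ext C x := ⟨hJx'.1, hJx'.2.imp fun Q hQ =>
    mem_of_sdiff_eq hD.symm hQ (hR' ▸ cons_append_ne hn hJi' hP' hxy)⟩
  -- Another route starting with `J ++ [x]` would belong to `C'` and cross a route starting with `J'
  -- ++ [y]`.
  have h1 : ∀ Q, J ++ x :: Q ∈ C → J ++ x :: Q = R := fun Q hQ => by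
    by_contra hne
    exact hC'.1.ext_noncrossing hi hx hy hJy' ⟨hJx.1, Q, mem_of_sdiff_eq hD hQ hne⟩ hJJ
  have h2 : ∀ Q, J' ++ y :: Q ∈ C' → J' ++ y :: Q = R' := fun Q hQ => by
    by_contra hne
    exact hC.1.ext_noncrossing hi hx hy ⟨hJy'.1, Q, mem_of_sdiff_eq hD.symm hQ hne⟩ hJx hJJ
  obtain rfl : J = P := by
    obtain ⟨-, Q, hQ⟩ := hJx
    exact (hJi.append_inj hn hP ((h1 Q hQ).trans hR)).1
  obtain rfl : J' = P' := by
    obtain ⟨-, Q, hQ⟩ := hJy'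
    exact (hJi'.append_inj hn hP' ((h2 Q hQ).trans hR')).1
  refine ⟨fun Q hQ => ?_, fun Q hQ => ?_, hJy, hJx'⟩
  · have h3 := (h1 Q hQ).trans hR
    simpa using h3
  · have h3 := (h2 Q hQ).trans hR'
    simpa using h3

/-- The continuation of two exchanged routes after the vertex `i` where they diverge: the slack edges
agree except for `x_{i+2}`, which is used by the second one only. -/
lemma exchange_tails (hn : 2 ≤ n) (hC : IsMaximalClique C) (hC' : IsMaximalClique C')
    (hD : C \ {R} = C' \ {R'}) (hRC : R ∈ C) (hRC' : R' ∈ C')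
    (hi : i ∈ inner n) (hx : IsX i x) (hy : IsY i y) (hR : R = P ++ x :: Z)
    (hR' : R' = P' ++ y :: Z') (hP : IsPath 1 P i) (hP' : IsPath 1 P' i) (hlt : PrefixLt P' P)
    {k : ℕ} {e : Edge n} (he : IsX k e) :
    (e ∈ Z → i + 2 < k) ∧ (e ∈ Z' ↔ e ∈ Z ∨ k = i + 2) := by
  have hi' := mem_inner.1 hi
  have hxs := hx.src_eq
  have hxt := hx.tgt_eq
  have hys := hy.src_eq (by omega)
  have hek := he.bounds
  obtain ⟨hPonly, hPonly', hPy, hPx'⟩ :=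
    exchange_branching hn hC hC' hD hRC hRC' hi hx hy hR hR' hP hP' hlt
  have hPx : P ∈ ext C x := ⟨hxs ▸ hP, Z, hR ▸ hRC⟩
  have hPy' : P' ∈ ext C' y := ⟨hys ▸ hP', Z', hR' ▸ hRC'⟩
  have hmax : ∀ A ∈ ext C x, ¬ PrefixLt P A := fun A hA => hC.1.ext_noncrossing hi hx hy hPy hA
  have hmin : ∀ A ∈ ext C' y, ¬ PrefixLt A P' := fun A hA =>
    hC'.1.ext_noncrossing hi hx hy hA hPx'
  have hZ : IsPath (i + 1) Z n := by
    have := (hC.1.1 _ (hR ▸ hRC)).right hP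
    rw [← hxt]; exact this.2
  have hZ' : IsPath (tgt y) Z' n := by
    have : IsPath i (y :: Z') n := (hC'.1.1 _ (hR' ▸ hRC')).right hP'
    exact this.2
  have hPx1 : IsPath 1 (P ++ [x]) (i + 1) := isPath_concat.2 ⟨hxs ▸ hP, hxt⟩
  rcases Nat.lt_or_ge (i + 1) n with h1 | h1
  swap
  -- For i = n - 1 both routes end with their edges out of i, and there is no x_{i+2}.
  · obtain rfl : n = i + 1 := by omega
    obtain rfl := hZ.eq_nil hn
    have hy' : IsY (i + 1 - 1) y := hy
    rw [hy'.tgt_last] at hZ'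
    obtain rfl := hZ'.eq_nil hn
    simp only [List.not_mem_nil, false_or, false_iff, false_implies, true_and]
    omega
  have hyt : tgt y = i + 2 := hy.tgt_eq (by omega)
  rw [hyt] at hZ'
  have hi1 : i + 1 ∈ inner n := mem_inner.2 (by omega)
  -- `P` is the highest prefix followed by `x`, and `x` is the higher edge into `i + 1`.
  have htop : ∀ A ∈ prefixes C (i + 1), A = P ++ [x] ∨ PrefixLt A (P ++ [x]) := by
    rintro A ⟨hA, Q, hQ⟩
    obtain ⟨A, h, rfl, hA, hh⟩ := hA.exists_concat (by omega)
    rw [List.append_assoc] at hQ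
    rcases isX_or_isY_of_tgt hi1 hh with h' | h'
    · obtain rfl := h'.unique hx
      rcases prefixLt_trichotomy hn hi (hxs ▸ hA) hP with h4 | h4 | h4
      · exact Or.inl (by rw [h4])
      · exact Or.inr (prefixLt_concat.2 (Or.inr ⟨rfl, h4⟩))
      · exact absurd h4 (hmax A ⟨hA, Q, hQ⟩)
    · exact Or.inr (prefixLt_concat.2 (Or.inl (inLt_of_isX_isY hi1 h' hx)))
  obtain ⟨g, Z₁, rfl, hg, hZ₁⟩ := hZ.exists_cons (by omega)
  -- A top prefix followed by the slack edge would be the branching one, but `P ++ [x]` has only one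
  -- continuation.
  have hgy : IsY (i + 1) g := by
    refine (isX_or_isY_of_src hi1 hg).resolve_left fun hgx => ?_
    obtain ⟨y₁, hy₁⟩ := exists_isY (n := n) (i := i + 1) (by omega)
    obtain ⟨J, hJx, hJy⟩ := hC.exists_branching hn hi1 hgx hy₁
    rcases htop J (ext_subset_prefixes hgx.src_eq hJx) with rfl | h
    · obtain ⟨-, Q, hQ⟩ := hJy
      have h3 := hPonly (y₁ :: Q) (by simpa using hQ)
      exact hgx.ne_isY hy₁ (List.cons.inj h3).1.symm
    · refine hC.1.ext_noncrossing hi1 hgx hy₁ hJy ⟨hg ▸ hPx1, Z₁, ?_⟩ h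
      simpa [← hR] using hRC
  have heg : e ≠ g := he.ne_isY hgy
  rcases Nat.lt_or_ge (i + 2) n with h2 | h2
  swap
  · obtain rfl : n = i + 2 := by omega
    have hgy' : IsY (i + 2 - 1) g := hgy
    rw [hgy'.tgt_last] at hZ₁
    obtain rfl := hZ₁.eq_nil hn
    obtain rfl := hZ'.eq_nil hn
    simp only [List.mem_singleton, heg, List.not_mem_nil, false_or, false_iff, false_implies,
      true_and]
    omega
  have hgt : tgt g = i + 3 := hgy.tgt_eq (by omega)
  rw [hgt] at hZ₁
  have hi2 : i + 2 ∈ inner n := mem_inner.2 (by omega)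
  have hPy2 : IsPath 1 (P' ++ [y]) (i + 2) := isPath_concat.2 ⟨hys ▸ hP', hyt⟩
  -- Dually, `P'` is the lowest prefix followed by `y` in `C'`, and `y` is the lower edge into `i +
  -- 2`.
  have hbot : ∀ A ∈ prefixes C' (i + 2), ¬ PrefixLt A (P' ++ [y]) := by
    rintro A ⟨hA, Q, hQ⟩ hA'
    obtain ⟨A, h, rfl, hA, hh⟩ := hA.exists_concat (by omega)
    rw [List.append_assoc] at hQ
    rw [prefixLt_concat] at hA'
    rcases isX_or_isY_of_tgt hi2 hh with h' | h'
    · rcases hA' with h4 | ⟨rfl, -⟩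
      · exact InLt.irrefl _ (h4.trans _ _ _ (inLt_of_isX_isY hi2 hy h'))
      · exact h'.ne_isY hy rfl
    · obtain rfl := h'.unique hy
      rcases hA' with h4 | ⟨-, h4⟩
      · exact InLt.irrefl _ h4
      · exact hmin A ⟨hA, Q, hQ⟩ h4
  obtain ⟨g', Z₁', rfl, hg', hZ₁'⟩ := hZ'.exists_cons (by omega)
  have hgx' : IsX (i + 2) g' := by
    refine (isX_or_isY_of_src hi2 hg').resolve_right fun hgy' => ?_
    obtain ⟨x₂, hx₂⟩ := exists_isX (n := n) (i := i + 2) (by omega) (by omega)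
    obtain ⟨J, hJx, hJy⟩ := hC'.exists_branching hn hi2 hx₂ hgy'
    have hJ := ext_subset_prefixes hx₂.src_eq hJx
    rcases prefixLt_trichotomy hn hi2 hPy2 hJ.1 with rfl | h | h
    · obtain ⟨-, Q, hQ⟩ := hJx
      have h3 := hPonly' (x₂ :: Q) (by simpa using hQ)
      exact hx₂.ne_isY hgy' (List.cons.inj h3).1
    · refine hC'.1.ext_noncrossing hi2 hx₂ hgy' ⟨hg' ▸ hPy2, Z₁', ?_⟩ hJx h
      simpa [← hR'] using hRC'
    · exact hbot J hJ h
  have hgt' : tgt g' = i + 3 := hgx'.tgt_eq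
  rw [hgt'] at hZ₁'
  -- At `i + 3` both exchanged prefixes lie above all remaining prefixes through y_{i+1} and below
  -- all those through x_{i+2}.
  have hZZ : Z₁ = Z₁' := by
    by_cases h3 : i + 3 = n
    · rw [h3] at hZ₁ hZ₁'
      rw [hZ₁.eq_nil hn, hZ₁'.eq_nil hn]
    have hi3 : i + 3 ∈ inner n := mem_inner.2 (by omega)
    have hgg : InLt g g' := inLt_of_isX_isY hi3 hgy hgx'
    refine tail_eq_of_exchange hn hC hC' hD hRC hRC' (k := i + 3) (by omega)
      (U := (P ++ [x]) ++ [g]) (U' := (P' ++ [y]) ++ [g']) (by simp [hR]) (by simp [hR'])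
      (isPath_concat.2 ⟨hg ▸ hPx1, hgt⟩) (isPath_concat.2 ⟨hg' ▸ hPy2, hgt'⟩)
      (fun Q hQ => ?_) (fun Q hQ => ?_) (fun A hA => ?_)
    · exact (List.cons.inj (hPonly (g :: Q) (by simpa using hQ))).2
    · exact (List.cons.inj (hPonly' (g' :: Q) (by simpa using hQ))).2
    · obtain ⟨hA, Q, hQ⟩ := hA
      have hQ' : A ++ Q ∈ C' := (hD ▸ hQ : A ++ Q ∈ C' \ {R'}).1
      obtain ⟨A, h, rfl, hA, hh⟩ := hA.exists_concat (by omega)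
      rw [List.append_assoc] at hQ hQ'
      rcases isX_or_isY_of_tgt hi3 hh with h' | h'
      · obtain rfl := h'.unique hgx'
        rw [hg'] at hA
        refine iff_of_false (fun h4 => ?_) (fun h4 => ?_)
        · rcases prefixLt_concat.1 h4 with h4 | ⟨h4, -⟩
          · exact InLt.irrefl _ (h4.trans _ _ _ hgg)
          · exact h'.ne_isY hgy h4
        · rcases prefixLt_concat.1 h4 with h4 | ⟨-, h4⟩
          · exact InLt.irrefl _ h4
          · exact hbot A ⟨hA, _, hQ'⟩ h4
      · obtain rfl := h'.unique hgy
        rw [hg] at hA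
        refine iff_of_true (prefixLt_concat.2 (Or.inr ⟨rfl, ?_⟩)) (prefixLt_concat.2 (Or.inl hgg))
        refine (htop A ⟨hA, _, hQ.1⟩).resolve_left ?_
        rintro rfl
        have h4 := hPonly (h :: Q) (by simpa using hQ.1)
        refine hQ.2 ?_
        simp [hR, ← h4]
  subst hZZ
  have heg' : e = g' ↔ k = i + 2 := by
    constructor
    · rintro rfl
      rw [← he.src_eq, hg']
    · rintro rfl
      exact he.unique hgx'
  have heZ : e ∈ Z₁ → i + 3 ≤ k := fun h => he.src_eq ▸ (hZ₁.src_mem hn h).1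
  simp only [List.mem_cons, heg, false_or, heg']
  exact ⟨fun h => heZ h, or_comm⟩

lemma IsPath.append_cons_cases (hn : 2 ≤ n) {A B L : List (Edge n)} {e : Edge n}
    (hA : IsPath 1 A (src e)) (hP : IsPath 1 P i) (h : A ++ e :: B = P ++ L) :
    (src e < i ∧ ∃ M, P = A ++ e :: M) ∨ (i ≤ src e ∧ ∃ K, A = P ++ K ∧ L = K ++ e :: B) := by
  rcases List.append_eq_append_iff.1 h with ⟨K, h1, h2⟩ | ⟨K, h1, h2⟩
  · cases K with
    | nil =>
      right
      rw [List.append_nil] at h1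
      subst h1
      exact ⟨(hP.unique hA).le, [], by simp, h2.symm⟩
    | cons f K =>
      left
      rw [List.cons_append, List.cons.injEq] at h2
      obtain ⟨rfl, -⟩ := h2
      refine ⟨?_, K, h1⟩
      rw [h1] at hP
      exact (hP.src_mem hn (e := e) (by simp)).2
  · right
    subst h1
    exact ⟨by have := (hA.right hP).add_length_le hn; omega, K, rfl, h2⟩

/-- The effect of an exchange on the degrees of the slack edges. -/
lemma exchange_ncard_ext (hn : 2 ≤ n) (hC : IsMaximalClique C) (hC' : IsMaximalClique C')
    (hD : C \ {R} = C' \ {R'}) (hRC : R ∈ C) (hRC' : R' ∈ C')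
    (hi : i ∈ inner n) (hx : IsX i x) (hy : IsY i y) (hR : R = P ++ x :: Z)
    (hR' : R' = P' ++ y :: Z') (hP : IsPath 1 P i) (hP' : IsPath 1 P' i) (hlt : PrefixLt P' P)
    {k : ℕ} {e : Edge n} (he : IsX k e) :
    (ext C' e).ncard + (if k = i then 1 else 0) =
      (ext C e).ncard + (if k = i + 2 then 1 else 0) := by
  have hi' := mem_inner.1 hi
  have hek := he.src_eq
  obtain ⟨hPonly, hPonly', hPy, hPx'⟩ :=
    exchange_branching hn hC hC' hD hRC hRC' hi hx hy hR hR' hP hP' hlt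
  rcases Nat.lt_or_ge k i with hk | hk
  -- Before `i` nothing changes: `P` is also followed by `y` in a surviving route, so the beginnings
  -- of `R` remain, and likewise for `P'` followed by `x`.
  · have heq : ext C e = ext C' e := by
      apply Set.Subset.antisymm
      · rintro A ⟨hA, Q, hQ⟩
        refine ⟨hA, ?_⟩
        by_cases hne : A ++ e :: Q = R
        · rcases hA.append_cons_cases hn hP (hne.trans hR) with ⟨-, M, rfl⟩ | ⟨h, -⟩
          · obtain ⟨-, Q₂, hQ₂⟩ := hPy
            have := mem_of_sdiff_eq hD hQ₂ (hR ▸ cons_append_ne hn hP hP (hx.ne_isY hy).symm)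
            exact ⟨M ++ y :: Q₂, by simpa using this⟩
          · omega
        · exact ⟨Q, mem_of_sdiff_eq hD hQ hne⟩
      · rintro A ⟨hA, Q, hQ⟩
        refine ⟨hA, ?_⟩
        by_cases hne : A ++ e :: Q = R'
        · rcases hA.append_cons_cases hn hP' (hne.trans hR') with ⟨-, M, rfl⟩ | ⟨h, -⟩
          · obtain ⟨-, Q₂, hQ₂⟩ := hPx'
            have := mem_of_sdiff_eq hD.symm hQ₂ (hR' ▸ cons_append_ne hn hP' hP' (hx.ne_isY hy))
            exact ⟨M ++ x :: Q₂, by simpa using this⟩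
          · omega
        · exact ⟨Q, mem_of_sdiff_eq hD.symm hQ hne⟩
    rw [heq, if_neg (by omega), if_neg (by omega)]
  -- From `i` on, a beginning of `R` that includes `e` contains `P ++ [x]`, hence belongs to `R`
  -- alone.
  have hCe := ncard_ext_eq_add hn hC.1 hRC (e := e) (fun A B Q hAB hQ => by
    have hA : IsPath 1 A (src e) := by
      obtain ⟨c, h1, h2⟩ := isPath_append.1 (hAB ▸ hC.1.1 R hRC : IsRoute (A ++ e :: B))
      rwa [show src e = c from h2.1]
    rcases hA.append_cons_cases hn hP (hAB.symm.trans hR) with ⟨h, -⟩ | ⟨-, K, rfl, hK⟩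
    · omega
    · rw [hR, List.append_assoc]
      congr 1
      cases K with
      | nil =>
        simp only [List.nil_append, List.cons.injEq] at hK
        obtain ⟨rfl, -⟩ := hK
        rw [List.nil_append, hPonly Q (by simpa using hQ)]
      | cons f K =>
        simp only [List.cons_append, List.cons.injEq] at hK
        obtain ⟨rfl, -⟩ := hK
        rw [List.cons_append, hPonly (K ++ e :: Q) (by simpa using hQ)])
  have hCe' := ncard_ext_eq_add hn hC'.1 hRC' (e := e) (fun A B Q hAB hQ => by
    have hA : IsPath 1 A (src e) := by
      obtain ⟨c, h1, h2⟩ := isPath_append.1 (hAB ▸ hC'.1.1 R' hRC' : IsRoute (A ++ e :: B))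
      rwa [show src e = c from h2.1]
    rcases hA.append_cons_cases hn hP' (hAB.symm.trans hR') with ⟨h, -⟩ | ⟨-, K, rfl, hK⟩
    · omega
    · rw [hR', List.append_assoc]
      congr 1
      cases K with
      | nil =>
        simp only [List.nil_append, List.cons.injEq] at hK
        exact absurd hK.1.symm (he.ne_isY hy)
      | cons f K =>
        simp only [List.cons_append, List.cons.injEq] at hK
        obtain ⟨rfl, -⟩ := hK
        rw [List.cons_append, hPonly' (K ++ e :: Q) (by simpa using hQ)])
  obtain ⟨ht1, ht2⟩ :=
    exchange_tails hn hC hC' hD hRC hRC' hi hx hy hR hR' hP hP' hlt he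
  have hePk : ∀ {L : List (Edge n)}, IsPath 1 L i → e ∉ L := fun hL h => by
    have := (hL.src_mem hn h).2
    omega
  have hex : e = x ↔ k = i := by
    constructor
    · rintro rfl
      rw [← hek, hx.src_eq]
    · rintro rfl
      exact he.unique hx
  have heR : e ∈ R ↔ k = i ∨ e ∈ Z := by
    rw [hR, List.mem_append, List.mem_cons, hex]
    simp [hePk hP]
  have heR' : e ∈ R' ↔ e ∈ Z ∨ k = i + 2 := by
    rw [hR', List.mem_append, List.mem_cons, ht2]
    simp [hePk hP', he.ne_isY hy]
  rw [hCe, hCe', hD]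
  -- Since `e ∈ Z` forces `k > i + 2`, the alternatives in `heR` and in `heR'` exclude each other
  -- and the indicators add up.
  grind

end Exchange

/-- Cliques with adjacent simplices are related by an exchange as above, in one of the two
directions. -/
lemma exists_conflict (hn : 2 ≤ n) {C C' : Set (List (Edge n))} (hC : IsMaximalClique C)
    (hC' : IsMaximalClique C') (hne : C ≠ C') {R R' : List (Edge n)} (hRC : R ∈ C)
    (hRC' : R' ∈ C') (hD : C \ {R} = C' \ {R'}) :
    ∃ i ∈ inner n, ∃ (x y : Edge n) (P P' Z Z' : List (Edge n)), IsX i x ∧ IsY i y ∧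
      IsPath 1 P i ∧ IsPath 1 P' i ∧
      ((R = P ++ x :: Z ∧ R' = P' ++ y :: Z' ∧ PrefixLt P' P) ∨
        (R' = P ++ x :: Z ∧ R = P' ++ y :: Z' ∧ PrefixLt P' P)) := by
  have key : ∀ {v : ℕ} {X Y X' Y' : List (Edge n)}, IsPath 1 X v → IsPath 1 X' v →
      IsPath v Y n → PrefixLt X' X → SuffixLt Y Y' → ∃ i ∈ inner n, ∃ (x y : Edge n)
      (P P' Z Z' : List (Edge n)), IsX i x ∧ IsY i y ∧ IsPath 1 P i ∧ IsPath 1 P' i ∧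
      X ++ Y = P ++ x :: Z ∧ X' ++ Y' = P' ++ y :: Z' ∧ PrefixLt P' P := by
    rintro v X Y X' Y' hX hX' hY hlt ⟨S, A, A', e, e', rfl, rfl, hs, hin, hl, hr⟩
    -- Appending the common part `S` to both prefixes keeps their order and moves the conflict to
    -- the vertex where the routes diverge.
    obtain ⟨c, hS, hc⟩ := isPath_append.1 hY
    obtain rfl : src e = c := hc.1
    refine ⟨src e, hin, e, e', X ++ S, X' ++ S, A, A', ?_, ?_, hX.append hS, hX'.append hS,
      by simp, by simp, (prefixLt_append_right S).2 hlt⟩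
    · refine (isX_or_isY_of_src hin rfl).resolve_right fun h => ?_
      have := h.isRight
      rcases e with k | k <;> simp at hl this
    · refine (isX_or_isY_of_src hin hs.symm).resolve_left fun h => ?_
      have := h.isLeft
      rcases e' with k | k <;> simp at hr this
  have hRnot : R ∉ C' := by
    intro h
    have hsub : C ≤ C' := fun T hT => by
      by_cases hTR : T = R
      · rwa [hTR]
      · exact mem_of_sdiff_eq hD hT hTR
    exact hne (le_antisymm hsub (hC.2 hC'.1 hsub))
  -- `R` is coherent with every other route of `C'`, so coherence with `R'` would put it into the
  -- maximal clique `C'`.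
  have hinc : ¬ Coherent R R' := by
    intro hcoh
    refine hRnot (hC'.mem_of_coherent hn (hC.1.1 R hRC) fun T hT => ?_)
    by_cases hTR : T = R'
    · rwa [hTR]
    · exact hC.1.2 R hRC T (mem_of_sdiff_eq hD.symm hT hTR)
  simp only [Coherent, not_forall, not_not] at hinc
  obtain ⟨v, hv, X, Y, X', Y', rfl, rfl, hX, hY, hX', hY', ⟨h1, h2⟩ | ⟨h1, h2⟩⟩ := hinc
  · obtain ⟨i, hi, x, y, P, P', Z, Z', hx, hy, hP, hP', h3, h4, h5⟩ := key hX' hX hY' h1 h2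
    exact ⟨i, hi, x, y, P, P', Z, Z', hx, hy, hP, hP', Or.inr ⟨h3, h4, h5⟩⟩
  · obtain ⟨i, hi, x, y, P, P', Z, Z', hx, hy, hP, hP', h3, h4, h5⟩ := key hX hX' hY h1 h2
    exact ⟨i, hi, x, y, P, P', Z, Z', hx, hy, hP, hP', Or.inl ⟨h3, h4, h5⟩⟩

/-- The slack edge degrees change as under the move `m_i^+`. -/
def SlackMove (i : ℕ) (C C' : Set (List (Edge n))) : Prop :=
  ∀ k (e : Edge n), IsX k e → (ext C' e).ncard + (if k = i then 1 else 0) =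
    (ext C e).ncard + (if k = i + 2 then 1 else 0)

lemma Adjacent.exists_slackMove (hn : 2 ≤ n) {C C' : Set (List (Edge n))} (hC : IsMaximalClique C)
    (hC' : IsMaximalClique C') (h : Adjacent (simplex C) (simplex C')) :
    ∃ i ∈ inner n, SlackMove i C C' ∨ SlackMove i C' C := by
  obtain ⟨hne, R, hRC, R', hRC', hD⟩ := h.exists_exchange hn hC.1 hC'.1
  obtain ⟨i, hi, x, y, P, P', Z, Z', hx, hy, hP, hP', ⟨h3, h4, h5⟩ | ⟨h3, h4, h5⟩⟩ :=
    exists_conflict hn hC hC' hne hRC hRC' hD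
  · exact ⟨i, hi, Or.inl fun k e he =>
      exchange_ncard_ext hn hC hC' hD hRC hRC' hi hx hy h3 h4 hP hP' h5 he⟩
  · exact ⟨i, hi, Or.inr fun k e he =>
      exchange_ncard_ext hn hC' hC hD.symm hRC' hRC hi hx hy h3 h4 hP hP' h5 he⟩

/-! ### From slack degrees to moves on flows and groves -/

section SlackMove

variable (hn : 2 ≤ n) {C C' : Set (List (Edge n))} (hC : IsMaximalClique C)
  (hC' : IsMaximalClique C') {i : ℕ} (hi : i ∈ inner n) (h : SlackMove i C C')
include hn hC hC' hi h

/-- The nonslack edge degrees are determined by the slack edge degrees. -/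
lemma SlackMove.nonslack (k : ℕ) (e : Edge n) (he : IsY k e) :
    (ext C' e).ncard + (if k = i + 1 then 1 else 0) =
      (ext C e).ncard + (if k = i then 1 else 0) := by
  have hi' := mem_inner.1 hi
  induction k using Nat.strong_induction_on generalizing e with
  | _ k ih =>
    rcases Nat.lt_or_ge k 2 with hk | hk
    -- `y_0` and `y_1` leave vertex `1` and have degree `1` in both cliques; as `i ≥ 2`, the move
    -- does not touch them.
    · have hs : src e = 1 := by
        rcases e with m | m
        · exact he.elim
        · simp only [IsY] at he
          simp only [src]
          split_ifs <;> omega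
      rw [hC.ncard_ext_source hn hs, hC'.ncard_ext_source hn hs, if_neg (by omega),
        if_neg (by omega)]
    · have hkn : k < n := by
        rcases e with m | m
        · exact he.elim
        · simp only [IsY] at he
          omega
      have hki : k ∈ inner n := mem_inner.2 (by omega)
      obtain ⟨x, hx⟩ := exists_isX (n := n) (i := k) (by omega) (by omega)
      obtain ⟨x', hx'⟩ := exists_isX (n := n) (i := k - 1) (by omega) (by omega)
      obtain ⟨y', hy'⟩ := exists_isY (n := n) (i := k - 2) (by omega)
      have h1 := hC.ncard_ext_add hn hki hx he
      have h2 := hC'.ncard_ext_add hn hki hx he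
      rw [ncard_prefixes hn hki hx' hy'] at h1 h2
      have h3 := h k x hx
      have h4 := h (k - 1) x' hx'
      have h5 := ih (k - 2) (by omega) y' hy'
      split_ifs at * <;> omega

lemma SlackMove.flowOf_plus :
    FlowPlusApplies (n := n) i (flowOf (groveOf C)) ∧
      flowOf (n := n) (groveOf C') = flowPlus i (flowOf (groveOf C)) := by
  have hns := h.nonslack hn hC hC' hi
  constructor
  · rintro e (he | he) <;> rw [hC.flowOf_groveOf hn]
    · have h1 := h i e he
      have h2 := hC'.ncard_ext_pos hn e
      rw [if_pos rfl, if_neg (by omega)] at h1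
      omega
    · have h1 := hns _ e he
      have h2 := hC'.ncard_ext_pos hn e
      rw [if_pos rfl, if_neg (by omega)] at h1
      omega
  · funext e
    simp only [flowPlus, hC.flowOf_groveOf hn, hC'.flowOf_groveOf hn]
    rcases e with m | m
    · have h1 := h _ (Sum.inl m) (show IsX (m.val + 1) (Sum.inl m : Edge n) from rfl)
      simp only [IsX, IsY, or_false]
      split_ifs at * <;> omega
    · have h1 := hns _ (Sum.inr m) (show IsY m.val (Sum.inr m : Edge n) from rfl)
      simp only [IsX, IsY, false_or]
      split_ifs at * <;> omega

/-- The same degree change read backwards, for the case in which `R` and `R'` swap roles. For groves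
no counterpart is needed, because `GroveMoveMinus` is by definition the reversed relation. -/
lemma SlackMove.flowOf_minus :
    FlowMinusApplies (n := n) i (flowOf (groveOf C')) ∧
      flowOf (n := n) (groveOf C) = flowMinus i (flowOf (groveOf C')) := by
  have hns := h.nonslack hn hC hC' hi
  constructor
  · rintro e (he | he) <;> rw [hC'.flowOf_groveOf hn]
    · have h1 := h _ e he
      have h2 := hC.ncard_ext_pos hn e
      rw [if_pos rfl, if_neg (by omega)] at h1
      omega
    · have h1 := hns _ e he
      have h2 := hC.ncard_ext_pos hn e
      rw [if_pos rfl, if_neg (by omega)] at h1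
      omega
  · funext e
    simp only [flowMinus, hC.flowOf_groveOf hn, hC'.flowOf_groveOf hn]
    rcases e with m | m
    · have h1 := h _ (Sum.inl m) (show IsX (m.val + 1) (Sum.inl m : Edge n) from rfl)
      simp only [IsX, IsY, or_false]
      split_ifs at * <;> omega
    · have h1 := hns _ (Sum.inr m) (show IsY m.val (Sum.inr m : Edge n) from rfl)
      simp only [IsX, IsY, false_or]
      split_ifs at * <;> omega

lemma SlackMove.groveMovePlus : GroveMovePlus n i (groveOf C) (groveOf C') := by
  have hi' := mem_inner.1 hi
  have hns := h.nonslack hn hC hC' hi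
  -- The size of a tree is the slack degree plus the nonslack degree minus one. At `i` the two
  -- changes cancel, at `i + 1` only y_{i+1} changes, at `i + 2` only x_{i+2}.
  have key : ∀ k ∈ inner n, ∃ p p' j j', groveOf C k = stair p j ∧ groveOf C' k = stair p' j' ∧
      1 ≤ j ∧ j ≤ p ∧ 1 ≤ j' ∧ j' ≤ p' ∧
      j' + (if k = i then 1 else 0) = j + (if k = i + 2 then 1 else 0) ∧
      p' + (if k = i + 1 then 1 else 0) = p + (if k = i + 2 then 1 else 0) := by
    intro k hk
    have hk' := mem_inner.1 hk
    obtain ⟨x, hx⟩ := exists_isX (n := n) (i := k) (by omega) (by omega)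
    obtain ⟨y, hy⟩ := exists_isY (n := n) (i := k) (by omega)
    have h1 := hC.ncard_ext_add hn hk hx hy
    have h2 := hC'.ncard_ext_add hn hk hx hy
    have h3 := h k x hx
    have h4 := hns k y hy
    have h5 := hC.ncard_ext_pos hn x
    have h6 := hC'.ncard_ext_pos hn x
    have h7 := hC.ncard_ext_pos hn y
    have h8 := hC'.ncard_ext_pos hn y
    refine ⟨_, _, _, _, hC.groveOf_eq_stair hn hk hx, hC'.groveOf_eq_stair hn hk hx, h5, by omega,
      h6, by omega, h3, ?_⟩
    split_ifs at * <;> omega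
  refine ⟨?_, fun hi1 => ?_, fun hi2 => ?_, fun k hk hk0 hk1 hk2 => ?_⟩
  · obtain ⟨p, p', j, j', h1, h2, h3, h4, h5, h6, h7, h8⟩ := key i hi
    rw [if_pos rfl, if_neg (by omega)] at h7
    rw [if_neg (by omega), if_neg (by omega)] at h8
    obtain rfl : p' = p := by omega
    obtain rfl : j = j' + 1 := by omega
    rw [h1, h2]
    refine ⟨j' + 1, by simp [stair], by simp [stair]; omega, by omega, ?_⟩
    ext1
    · rfl
    · ext ⟨a, b⟩
      simp only [stair, Set.mem_ofPred_eq, Set.mem_union, Set.mem_sdiff, Set.mem_singleton_iff,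
        Prod.mk.injEq]
      omega
  · obtain ⟨p, p', j, j', h1, h2, h3, h4, h5, h6, h7, h8⟩ := key (i + 1) (mem_inner.2 (by omega))
    rw [if_neg (by omega), if_neg (by omega)] at h7
    rw [if_pos rfl, if_neg (by omega)] at h8
    obtain rfl : j' = j := by omega
    obtain rfl : p = p' + 1 := by omega
    rw [h1, h2]
    refine ⟨?_, ?_⟩
    -- The branching vertex is at most `p'`, so the top left vertex `p' + 1` is not joined to `r_1`.
    · simp only [stair, Set.mem_ofPred_eq]
      omega
    · ext1
      · rfl
      · ext ⟨a, b⟩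
        simp only [stair, Set.mem_ofPred_eq]
        omega
  · obtain ⟨p, p', j, j', h1, h2, h3, h4, h5, h6, h7, h8⟩ := key (i + 2) (mem_inner.2 (by omega))
    rw [if_neg (by omega), if_pos rfl] at h7
    rw [if_neg (by omega), if_pos rfl] at h8
    obtain rfl : j' = j + 1 := by omega
    obtain rfl : p' = p + 1 := by omega
    rw [h1, h2]
    ext1
    · rfl
    · ext ⟨a, b⟩
      simp only [stair, Set.mem_ofPred_eq, Set.mem_union, Set.mem_image, Set.mem_singleton_iff,
        Prod.mk.injEq, Prod.exists]
      constructor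
      · intro hab
        by_cases h1 : a = 1 ∧ b = 1
        · exact Or.inr h1
        · exact Or.inl ⟨a - 1, b, by omega, by omega, rfl⟩
      · rintro (⟨c, d, hcd, rfl, rfl⟩ | h1) <;> omega
  · obtain ⟨p, p', j, j', h1, h2, h3, h4, h5, h6, h7, h8⟩ := key k hk
    rw [if_neg hk0, if_neg hk2] at h7
    rw [if_neg hk1, if_neg hk2] at h8
    obtain rfl : j' = j := by omega
    obtain rfl : p' = p := by omega
    rw [h1, h2]

end SlackMove

end CZig

/-- If the simplices of two maximal cliques are adjacent, then the corresponding integer flows differ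
by an elementary move, and so do the corresponding groves. -/
theorem theorem1 (n : ℕ) (hn : 2 ≤ n) (C C' : Set (List (CZig.Edge n)))
    (hC : CZig.IsMaximalClique C) (hC' : CZig.IsMaximalClique C')
    (hadj : CZig.Adjacent (CZig.simplex C) (CZig.simplex C'))
    (Γ Γ' : ℕ → CZig.BipGraph) (hΓ : Γ = CZig.groveOf C) (hΓ' : Γ' = CZig.groveOf C')
    (φ φ' : CZig.Edge n → ℤ) (hφ : φ = CZig.flowOf Γ) (hφ' : φ' = CZig.flowOf Γ') :
    (CZig.IsIntegerFlow φ ∧ CZig.IsIntegerFlow φ' ∧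
      ∃ i ∈ CZig.inner n,
        (CZig.FlowPlusApplies i φ ∧ φ' = CZig.flowPlus i φ) ∨
        (CZig.FlowMinusApplies i φ ∧ φ' = CZig.flowMinus i φ)) ∧
    (CZig.IsGrove n Γ ∧ CZig.IsGrove n Γ' ∧
      ∃ i ∈ CZig.inner n,
        CZig.GroveMovePlus n i Γ Γ' ∨ CZig.GroveMoveMinus n i Γ Γ') := by
  subst hΓ hΓ' hφ hφ'
  obtain ⟨i, hi, h⟩ := CZig.Adjacent.exists_slackMove hn hC hC' hadj
  refine ⟨⟨hC.isIntegerFlow hn, hC'.isIntegerFlow hn, i, hi, ?_⟩, hC.isGrove hn, hC'.isGrove hn,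
    i, hi, ?_⟩
  · exact h.imp (fun h => h.flowOf_plus hn hC hC' hi) (fun h => h.flowOf_minus hn hC' hC hi)
  · exact h.imp (fun h => h.groveMovePlus hn hC hC' hi) (fun h => h.groveMovePlus hn hC' hC hi)
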